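/- Let $a,b>0$, $1<p<5$, and let $V\in C^1(\mathbb R^3)$ satisfy (V1): $V\in L^\infty(\mathbb R^3)$ and $0<\inf_{\mathbb R^3}V\le\sup_{\mathbb R^3}V<\infty$. Let $k\ge 1$ and let $a_1,\dots,a_k\in\mathbb R^3$ be distinct. For small $\epsilon>0$ consider the Kirchhoff equation $$-\Big(\epsilon^2a+\epsilon b\int_{\mathbb R^3}|\nabla u|^2\Big)\Delta u+V(x)u=u^p,\qquad u>0\quad\text{in }\mathbb R^3. \tag{K}$$ Solutions are understood as continuous, everywhere positive functions in $H^1(\mathbb R^3)$ that satisfy the equation in the sense of distributions; the same applies to the system (S) below. Suppose that $u_\epsilon$ (defined for all sufficiently small $\epsilon>0$) is a $k$-peak solution of (K), that is, $u_\epsilon$ solves (K) and (i) $u_\epsilon$ has local maximum points $y^1_\epsilon,\dots,y^k_\epsilon$ with $y^i_\epsilon\to a_i$ as $\epsilon\to0$; (ii) for every $\tau>0$ there is $R>0$ such that, for all sufficiently small $\epsilon>0$, $|u_\epsilon(x)|\le\tau$ for $x\in\mathbb R^3\setminus\bigcup_{j=1}^kB_{R\epsilon}(y^j_\epsilon)$;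 (iii) there is $C>0$ such that $\int_{\mathbb R^3}(\epsilon^2a|\nabla u_\epsilon|^2+u_\epsilon^2)\le C\epsilon^3$ for all sufficiently small $\epsilon>0$. Suppose moreover that, for all sufficiently small $\epsilon>0$, $$u_\epsilon(x)=\sum_{i=1}^kw^i\Big(\frac{x-y^i_\epsilon}{\epsilon}\Big)+\varphi_\epsilon(x),$$ where $(w^1,\dots,w^k)$ is a positive radial solution, with every $w^i\in H^1(\mathbb R^3)$, of the system $$-\Big(a+b\sum_{j=1}^k\int_{\mathbb R^3}|\nabla w^j|^2\Big)\Delta w^i+V(a_i)w^i=(w^i)^p\quad\text{in }\mathbb R^3,\qquad 1\le i\le k, \tag{S}$$ and $\varphi_\epsilon\in H^1(\mathbb R^3)$ satisfies $\|\varphi_\epsilon\|_\epsilon=o(\epsilon^{3/2})$ as $\epsilon\to0$, with $\|\varphi\|_\epsilon^2=\int_{\mathbb R^3}(\epsilon^2a|\nabla\varphi|^2+V\varphi^2)$. Then $\nabla V(a_i)=0$ for every $i=1,\dots,k$. -/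

import Mathlib

open MeasureTheory Filter Topology Set
open scoped ContDiff Gradient

/-- Three-dimensional Euclidean space. -/
abbrev E3 : Type := EuclideanSpace ℝ (Fin 3)

/-- Real test functions on `ℝ³`: smooth with compact support. -/
def IsTestFunction (η : E3 → ℝ) : Prop :=
  ContDiff ℝ ∞ η ∧ HasCompactSupport η

/-- `G` is a weak gradient of `u` on `ℝ³`:
`∫ u ∇η = - ∫ η G` (a vector identity) for every test function `η`. -/
def IsWeakGradient (u : E3 → ℝ) (G : E3 → E3) : Prop :=
  LocallyIntegrable u ∧ LocallyIntegrable G ∧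
    ∀ η : E3 → ℝ, IsTestFunction η → ∫ x, u x • ∇ η x = - ∫ x, η x • G x

/-- Weak gradients are unique up to null sets. -/
theorem IsWeakGradient.ae_eq {u : E3 → ℝ} {G H : E3 → E3}
    (hG : IsWeakGradient u G) (hH : IsWeakGradient u H) : G =ᵐ[volume] H := by
  refine ae_eq_of_integral_contDiff_smul_eq hG.2.1 hH.2.1 fun η hη hc => ?_
  have h1 := hG.2.2 η ⟨hη, hc⟩
  have h2 := hH.2.2 η ⟨hη, hc⟩
  exact neg_injective (h1.symm.trans h2)

open Classical in
/-- The weak gradient of `u` (well defined up to null sets; zero if there is none). -/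
noncomputable def weakGrad (u : E3 → ℝ) : E3 → E3 :=
  if h : ∃ G, IsWeakGradient u G then h.choose else 0

/-- A weak gradient agrees with `weakGrad` almost everywhere. -/
theorem IsWeakGradient.weakGrad_ae_eq {u : E3 → ℝ} {G : E3 → E3}
    (hG : IsWeakGradient u G) : weakGrad u =ᵐ[volume] G := by
  have h : ∃ G, IsWeakGradient u G := ⟨G, hG⟩
  have hw : IsWeakGradient u (weakGrad u) := by
    rw [weakGrad, dif_pos h]
    exact h.choose_spec
  exact hw.ae_eq hG

/-- `u ∈ H¹(ℝ³)`: `u` is square integrable and has a square integrable weak gradient. -/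
def MemH1 (u : E3 → ℝ) : Prop :=
  MemLp u 2 ∧ ∃ G : E3 → E3, MemLp G 2 ∧ IsWeakGradient u G

/-- The Dirichlet integral `∫ |∇u|²`. -/
noncomputable def dirichlet (u : E3 → ℝ) : ℝ :=
  ∫ x, ‖weakGrad u x‖ ^ 2

/-- Condition (V1): `V ∈ L^∞(ℝ³)` and `0 < inf V ≤ sup V < ∞`.
(If `V` is not bounded below then `⨅ x, V x = 0`, so the second field forces boundedness below.) -/
structure CondV1 (V : E3 → ℝ) : Prop where
  memLp : MemLp V ⊤
  inf_pos : 0 < ⨅ x, V x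
  bddAbove : BddAbove (range V)

/-- `u ∈ H¹(ℝ³)` is a positive solution of `-A Δu + W u = u^p` in `ℝ³`, in the sense of
distributions; as an `H¹` function, `u` is represented by a continuous function. -/
structure IsPositiveSolution (A : ℝ) (W : E3 → ℝ) (p : ℝ) (u : E3 → ℝ) : Prop where
  memH1 : MemH1 u
  continuous : Continuous u
  pos : ∀ x, 0 < u x
  weak_eq : ∀ η : E3 → ℝ, IsTestFunction η →
    A * (∫ x, inner ℝ (weakGrad u x) (∇ η x)) + ∫ x, W x * u x * η x
      = ∫ x, u x ^ p * η x

/-- `u` is a positive solution of the Kirchhoff equation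
`-(ε² a + ε b ∫ |∇u|²) Δu + V u = u^p` in `ℝ³`. -/
def IsKirchhoffSolution (a b p : ℝ) (V : E3 → ℝ) (ε : ℝ) (u : E3 → ℝ) : Prop :=
  IsPositiveSolution (ε ^ 2 * a + ε * b * dirichlet u) V p u

/-- The family `u ε`, for small `ε > 0`, is a `k`-peak solution of the Kirchhoff equation, with
local maximum points `y ε i` converging to the concentration points `c i`. -/
structure IsMultiPeakSolution (a b p : ℝ) (V : E3 → ℝ) {k : ℕ} (c : Fin k → E3)
    (y : ℝ → Fin k → E3) (u : ℝ → E3 → ℝ) : Prop where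
  solution : ∀ᶠ ε in 𝓝[>] (0 : ℝ), IsKirchhoffSolution a b p V ε (u ε)
  localMax : ∀ᶠ ε in 𝓝[>] (0 : ℝ), ∀ i, IsLocalMax (u ε) (y ε i)
  tendsto : ∀ i, Tendsto (fun ε => y ε i) (𝓝[>] (0 : ℝ)) (𝓝 (c i))
  decay : ∀ τ > (0 : ℝ), ∃ R > (0 : ℝ), ∀ᶠ ε in 𝓝[>] (0 : ℝ),
    ∀ x, x ∉ ⋃ i, Metric.ball (y ε i) (R * ε) → |u ε x| ≤ τ
  energy : ∃ C > (0 : ℝ), ∀ᶠ ε in 𝓝[>] (0 : ℝ),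
    ∫ x, (ε ^ 2 * a * ‖weakGrad (u ε) x‖ ^ 2 + u ε x ^ 2) ≤ C * ε ^ 3

/-- `(w 1, …, w k)` is a positive radial solution of the limit system
`-(a + b ∑ⱼ ∫ |∇wʲ|²) Δwⁱ + V(cᵢ) wⁱ = (wⁱ)^p`, `wⁱ > 0`, `wⁱ ∈ H¹(ℝ³)`. -/
def IsRadialLimitSolution (a b p : ℝ) (V : E3 → ℝ) {k : ℕ} (c : Fin k → E3)
    (w : Fin k → E3 → ℝ) : Prop :=
  ∀ i, IsPositiveSolution (a + b * ∑ j, dirichlet (w j)) (fun _ => V (c i)) p (w i) ∧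
    ∀ x x', ‖x‖ = ‖x'‖ → w i x = w i x'

/-- The norm `‖φ‖_ε = (∫ ε² a |∇φ|² + V φ²)^{1/2}`. -/
noncomputable def normEps (a : ℝ) (V : E3 → ℝ) (ε : ℝ) (φ : E3 → ℝ) : ℝ :=
  Real.sqrt (∫ x, (ε ^ 2 * a * ‖weakGrad φ x‖ ^ 2 + V x * φ x ^ 2))

/-- For small `ε > 0` the family has the form `u ε = ∑ᵢ wⁱ((· - y ε i) / ε) + φ ε`, where
`(w 1, …, w k)` is a positive radial solution of the limit system, `φ ε ∈ H¹(ℝ³)` (for bounded `V`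
the norm `‖·‖_ε` is finite on `H¹`), and `‖φ ε‖_ε = o(ε^{3/2})`. -/
structure HasPeakForm (a b p : ℝ) (V : E3 → ℝ) {k : ℕ} (c : Fin k → E3)
    (y : ℝ → Fin k → E3) (w : Fin k → E3 → ℝ) (φ u : ℝ → E3 → ℝ) : Prop where
  limit : IsRadialLimitSolution a b p V c w
  form : ∀ᶠ ε in 𝓝[>] (0 : ℝ), ∀ x, u ε x = ∑ i, w i (ε⁻¹ • (x - y ε i)) + φ ε x
  memH1 : ∀ᶠ ε in 𝓝[>] (0 : ℝ), MemH1 (φ ε)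
  small : (fun ε => normEps a V ε (φ ε)) =o[𝓝[>] (0 : ℝ)] fun ε => ε ^ (3 / 2 : ℝ)

/-!
# Peaks of Kirchhoff solutions concentrate at critical points of the potential

Suppose `e = ∇V(cᵢ) ≠ 0` and choose a small ball about `cᵢ` on which `∂ₑV ≥ m > 0` and whose outer
annulus stays away from all concentration points. Write `A = ε² a + ε b ∫ |∇u|²`. Testing
`-A Δu + V u = u^p` with `χ ∂ₑu`, where `χ` is a cutoff on this ball, gives a local Pohozaev
identity: `∫ χ ∂ₑV u²` equals a sum of terms `A ∇χ ∇u ∇u`, `V ∂ₑχ u²` and `∂ₑχ u^{p+1}`, all of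
which live on the annulus where `∇χ ≠ 0`. There `u ≤ 1`, so `u^{p+1} ≤ u²`, and the energy bound
gives `A = O(ε²)`; hence `m ∫ χ u²` is at most a constant times the energy
`∫ (ε² |∇u|² + u²)` over the annulus (`mul_integral_mul_sq_le_energy`).

Decompose `u` into peaks and remainder. A peak contributes to this energy `ε³` times the tail,
outside a ball of radius of order `1 / ε`, of the integrable function `|∇wˡ|² + (wˡ)²`, and the
remainder contributes `O(‖φ‖_ε²) = o(ε³)` (`setIntegral_energy_le`, `integral_energy_le_normEps`).
So `∫ χ u² = o(ε³)`. On the other hand all peaks are positive, so that `wⁱ((· - yⁱ) / ε) ≤ u - φ`,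
and therefore `∫ χ u² ≥ (1 / 2 - o(1)) ε³ ∫ (wⁱ)²` (`mul_integral_peak_sq_le`): a contradiction.

No regularity theory is used for the Pohozaev identity. It is replaced by an inequality
(`abs_integral_fderiv_potential_mul_sq_le`), obtained by mollifying `u`: the mollified equation
`-A Δ(ρ ⋆ u) = ρ ⋆ (u^p - V u)` holds pointwise, its right-hand side converges locally uniformly
because `u` is continuous, and the gradients `ρ ⋆ ∇u` are controlled in `L²` by Jensen's inequality.
-/

open scoped Convolution

/-! ### Integration by parts for smooth functions -/

theorem integral_fderiv_apply_eq_zero {f : E3 → ℝ} (hf : ContDiff ℝ 1 f)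
    (hc : HasCompactSupport f) (e : E3) : ∫ x, fderiv ℝ f x e = 0 := by
  have hcont : Continuous fun x => fderiv ℝ f x e :=
    (hf.continuous_fderiv one_ne_zero).clm_apply continuous_const
  have h := integral_mul_fderiv_eq_neg_fderiv_mul_of_integrable (μ := volume)
    (f := fun _ : E3 => (1 : ℝ)) (g := f) (v := e)
    (by simp) (by simpa using hcont.integrable_of_hasCompactSupport (hc.fderiv_apply (𝕜 := ℝ) e))
    (by simpa using hf.continuous.integrable_of_hasCompactSupport hc)
    (fun x _ => differentiableAt_const _) (fun x _ => hf.differentiable one_ne_zero x)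
  simpa using h

theorem continuous_gradient {f : E3 → ℝ} (hf : ContDiff ℝ 1 f) : Continuous (∇ f) :=
  (InnerProductSpace.toDual ℝ E3).symm.continuous.comp (hf.continuous_fderiv one_ne_zero)

theorem gradient_eq_zero_of_fderiv {f : E3 → ℝ} {x : E3} (h : fderiv ℝ f x = 0) :
    ∇ f x = 0 := by
  rw [gradient, h, map_zero]

theorem fderiv_fderiv_apply_comm {v : E3 → ℝ} (hv : ContDiff ℝ 2 v) (x d e : E3) :
    fderiv ℝ (fun z => fderiv ℝ v z d) x e = fderiv ℝ (fun z => fderiv ℝ v z e) x d := by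
  have h1 : DifferentiableAt ℝ (fderiv ℝ v) x :=
    (hv.fderiv_right (m := 1) (by norm_num)).differentiable one_ne_zero x
  have hs : IsSymmSndFDerivAt ℝ v x :=
    hv.contDiffAt.isSymmSndFDerivAt (by simp)
  rw [fderiv_clm_apply h1 (differentiableAt_const d), fderiv_clm_apply h1 (differentiableAt_const e)]
  simpa using hs e d

/-- The standard orthonormal basis of `ℝ³`. -/
noncomputable abbrev stdBasis : OrthonormalBasis (Fin 3) ℝ E3 := EuclideanSpace.basisFun (Fin 3) ℝ

theorem sum_fderiv_mul_fderiv (f g : E3 → ℝ) (x : E3) :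
    ∑ i, fderiv ℝ f x (stdBasis i) * fderiv ℝ g x (stdBasis i) = inner ℝ (∇ f x) (∇ g x) := by
  rw [← stdBasis.sum_inner_mul_inner]
  refine Finset.sum_congr rfl fun i _ => ?_
  rw [inner_gradient_left, real_inner_comm, inner_gradient_left]

/-- Testing `Δv` with `η ∂ₑv`: up to divergences, `η ∂ₑv Δv` is a quadratic expression in `∇v` with
coefficients from `∇η`, since `η ∇v · ∇(∂ₑv) = η ∂ₑ(|∇v|²) / 2`. -/
theorem integral_mul_fderiv_mul_laplacian {v η : E3 → ℝ} (hv : ContDiff ℝ 2 v)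
    (hη : ContDiff ℝ 1 η) (hc : HasCompactSupport η) (e : E3) :
    ∫ x, η x * fderiv ℝ v x e * ∑ i, fderiv ℝ (fun z => fderiv ℝ v z (stdBasis i)) x (stdBasis i)
      = ∫ x, (1 / 2 * (fderiv ℝ η x e * ‖∇ v x‖ ^ 2)
          - inner ℝ (∇ η x) (∇ v x) * fderiv ℝ v x e) := by
  have hd : ∀ d : E3, ContDiff ℝ 1 fun x => fderiv ℝ v x d := fun d =>
    (hv.fderiv_right (m := 1) (by norm_num)).clm_apply contDiff_const
  have hF : ∀ i, ContDiff ℝ 1 fun x => η x * (fderiv ℝ v x e * fderiv ℝ v x (stdBasis i)) :=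
    fun i => hη.mul ((hd e).mul (hd _))
  have hFc : ∀ i, HasCompactSupport
      fun x => η x * (fderiv ℝ v x e * fderiv ℝ v x (stdBasis i)) := fun i => hc.mul_right
  have hH : ∀ i, ContDiff ℝ 1 fun x => η x * (fderiv ℝ v x (stdBasis i)) ^ 2 :=
    fun i => hη.mul ((hd _).pow 2)
  have hHc : ∀ i, HasCompactSupport fun x => η x * (fderiv ℝ v x (stdBasis i)) ^ 2 :=
    fun i => hc.mul_right
  have hint : ∀ {f : E3 → ℝ} (hf : ContDiff ℝ 1 f) (hc : HasCompactSupport f) (d : E3),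
      Integrable fun x => fderiv ℝ f x d := fun hf hc d =>
    ((hf.continuous_fderiv one_ne_zero).clm_apply continuous_const).integrable_of_hasCompactSupport
      (hc.fderiv_apply (𝕜 := ℝ) d)
  have hzero : ∫ x, (∑ i, (fderiv ℝ (fun x => η x * (fderiv ℝ v x e * fderiv ℝ v x (stdBasis i))) x
        (stdBasis i) - 1 / 2 * fderiv ℝ (fun x => η x * (fderiv ℝ v x (stdBasis i)) ^ 2) x e)) = 0 := by
    rw [integral_finsetSum]
    · refine Finset.sum_eq_zero fun i _ => ?_
      rw [integral_sub (hint (hF i) (hFc i) _) ((hint (hH i) (hHc i) _).const_mul _),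
        integral_const_mul, integral_fderiv_apply_eq_zero (hF i) (hFc i),
        integral_fderiv_apply_eq_zero (hH i) (hHc i)]
      simp
    · exact fun i _ => (hint (hF i) (hFc i) _).sub ((hint (hH i) (hHc i) _).const_mul _)
  have hL : Integrable fun x => η x * fderiv ℝ v x e *
      ∑ i, fderiv ℝ (fun z => fderiv ℝ v z (stdBasis i)) x (stdBasis i) := by
    refine Continuous.integrable_of_hasCompactSupport ?_ (hc.mul_right.mul_right)
    refine (hη.continuous.mul (hd e).continuous).mul (continuous_finsetSum _ fun i _ => ?_)
    exact ((hd _).continuous_fderiv one_ne_zero).clm_apply continuous_const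
  have hR : Integrable fun x => (1 / 2 * (fderiv ℝ η x e * ‖∇ v x‖ ^ 2)
          - inner ℝ (∇ η x) (∇ v x) * fderiv ℝ v x e) := by
    have hv1 : ContDiff ℝ 1 v := hv.of_le (by norm_num)
    refine Continuous.integrable_of_hasCompactSupport ?_ ?_
    · refine (continuous_const.mul ((((hη.continuous_fderiv one_ne_zero).clm_apply
        continuous_const)).mul ((continuous_gradient hv1).norm.pow 2))).sub ?_
      exact ((continuous_gradient hη).inner (continuous_gradient hv1)).mul (hd e).continuous
    · refine (hc.fderiv (𝕜 := ℝ)).mono fun x hx => ?_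
      contrapose! hx
      have h0 : fderiv ℝ η x = 0 := by simpa using hx
      have h1 : ∇ η x = 0 := gradient_eq_zero_of_fderiv h0
      simp [h0, h1]
  rw [← sub_eq_zero, ← integral_sub hL hR, ← hzero]
  refine integral_congr_ae (Eventually.of_forall fun x => ?_)
  have hηx : DifferentiableAt ℝ η x := hη.differentiable one_ne_zero x
  have hdx : ∀ d, DifferentiableAt ℝ (fun x => fderiv ℝ v x d) x :=
    fun d => (hd d).differentiable one_ne_zero x
  have key : ∀ i, (fderiv ℝ (fun x => η x * (fderiv ℝ v x e * fderiv ℝ v x (stdBasis i))) x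
        (stdBasis i) - 1 / 2 * fderiv ℝ (fun x => η x * (fderiv ℝ v x (stdBasis i)) ^ 2) x e)
      = η x * fderiv ℝ v x e * fderiv ℝ (fun z => fderiv ℝ v z (stdBasis i)) x (stdBasis i)
        - (1 / 2 * (fderiv ℝ η x e * (fderiv ℝ v x (stdBasis i) * fderiv ℝ v x (stdBasis i)))
          - fderiv ℝ η x (stdBasis i) * fderiv ℝ v x (stdBasis i) * fderiv ℝ v x e) := by
    intro i
    rw [fderiv_fun_mul hηx ((hdx e).fun_mul (hdx _)), fderiv_fun_mul (hdx e) (hdx _),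
      fderiv_fun_mul hηx ((hdx _).fun_pow 2), fderiv_fun_pow 2 (hdx _)]
    simp only [add_apply, smul_apply, smul_eq_mul,
      nsmul_eq_mul]
    rw [fderiv_fderiv_apply_comm hv x (stdBasis i) e]
    push_cast
    ring
  simp only [key]
  rw [Finset.sum_sub_distrib, Finset.sum_sub_distrib, ← Finset.mul_sum, ← Finset.mul_sum,
    ← Finset.mul_sum, ← Finset.sum_mul, sum_fderiv_mul_fderiv, sum_fderiv_mul_fderiv,
    real_inner_self_eq_norm_sq]

/-! ### Mollification of functions with a weak gradient -/

/-- The convolution `ρ ⋆ f` of a real kernel with a scalar or vector valued function on `ℝ³`. -/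
noncomputable def mollify {F : Type*} [NormedAddCommGroup F] [NormedSpace ℝ F]
    (ρ : E3 → ℝ) (f : E3 → F) : E3 → F :=
  ρ ⋆[ContinuousLinearMap.lsmul ℝ ℝ, volume] f

theorem mollify_apply {F : Type*} [NormedAddCommGroup F] [NormedSpace ℝ F]
    (ρ : E3 → ℝ) (f : E3 → F) (x : E3) : mollify ρ f x = ∫ y, ρ (x - y) • f y :=
  convolution_lsmul_swap

namespace IsTestFunction

variable {ρ : E3 → ℝ}

theorem contDiff_one (hρ : IsTestFunction ρ) : ContDiff ℝ 1 ρ := hρ.1.of_le (by norm_cast)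

theorem hasCompactSupport_gradient (hρ : IsTestFunction ρ) :
    HasCompactSupport (∇ ρ) :=
  (hρ.2.fderiv (𝕜 := ℝ)).mono fun z hz => by
    contrapose! hz
    simpa using gradient_eq_zero_of_fderiv (by simpa using hz)

theorem comp_const_sub (hρ : IsTestFunction ρ) (x : E3) :
    IsTestFunction fun y => ρ (x - y) :=
  ⟨hρ.1.comp (contDiff_const.sub contDiff_id),
    hρ.2.comp_homeomorph (Homeomorph.subLeft x)⟩

theorem gradient_comp_const_sub (hρ : IsTestFunction ρ) (x y : E3) :
    ∇ (fun y => ρ (x - y)) y = - ∇ ρ (x - y) := by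
  have h : HasFDerivAt (fun y => ρ (x - y)) ((fderiv ℝ ρ (x - y)).comp (- .id ℝ E3)) y :=
    ((hρ.contDiff_one.differentiable one_ne_zero (x - y)).hasFDerivAt).comp y
      ((hasFDerivAt_id y).const_sub x)
  rw [gradient, h.fderiv, gradient, ← map_neg]
  congr 1
  ext; simp

theorem integrable_smul {F : Type*} [NormedAddCommGroup F] [NormedSpace ℝ F]
    (hρ : IsTestFunction ρ) {f : E3 → F} (hf : LocallyIntegrable f) (x : E3) :
    Integrable fun y => ρ (x - y) • f y :=
  hf.integrable_smul_left_of_hasCompactSupport (hρ.comp_const_sub x).1.continuous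
    (hρ.comp_const_sub x).2

theorem contDiff_mollify (hρ : IsTestFunction ρ) {F : Type*} [NormedAddCommGroup F]
    [NormedSpace ℝ F] {f : E3 → F} (hf : LocallyIntegrable f) : ContDiff ℝ ∞ (mollify ρ f) :=
  hρ.2.contDiff_convolution_left _ hρ.1 hf

theorem integrable_fderiv_mul (hρ : IsTestFunction ρ) {f : E3 → ℝ} (hf : LocallyIntegrable f)
    (x e : E3) : Integrable fun y => fderiv ℝ ρ (x - y) e * f y := by
  refine hf.integrable_smul_left_of_hasCompactSupport (g := fun y => fderiv ℝ ρ (x - y) e) ?_ ?_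
  · exact ((hρ.contDiff_one.continuous_fderiv one_ne_zero).comp
      (continuous_const.sub continuous_id)).clm_apply continuous_const
  · exact (hρ.2.fderiv_apply (𝕜 := ℝ) e).comp_homeomorph (Homeomorph.subLeft x)

theorem fderiv_mollify_apply (hρ : IsTestFunction ρ) {f : E3 → ℝ} (hf : LocallyIntegrable f)
    (x e : E3) : fderiv ℝ (mollify ρ f) x e = ∫ y, fderiv ℝ ρ (x - y) e * f y := by
  have h := hρ.2.hasFDerivAt_convolution_left (ContinuousLinearMap.lsmul ℝ ℝ) (μ := volume)
    hρ.contDiff_one hf x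
  have hex := (hρ.2.fderiv (𝕜 := ℝ)).convolutionExists_left
    ((ContinuousLinearMap.lsmul ℝ ℝ : ℝ →L[ℝ] ℝ →L[ℝ] ℝ).precompL E3) (μ := volume)
    (hρ.contDiff_one.continuous_fderiv one_ne_zero) hf x
  rw [mollify, h.fderiv, convolution_eq_swap, ContinuousLinearMap.integral_apply hex.integrable_swap]
  simp

end IsTestFunction

namespace IsWeakGradient

variable {ρ u : E3 → ℝ} {G : E3 → E3}

/-- Mollification commutes with the weak gradient. -/
theorem fderiv_mollify_apply (hG : IsWeakGradient u G) (hρ : IsTestFunction ρ) (x e : E3) :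
    fderiv ℝ (mollify ρ u) x e = inner ℝ (mollify ρ G x) e := by
  have h := hG.2.2 _ (hρ.comp_const_sub x)
  simp only [hρ.gradient_comp_const_sub, smul_neg, integral_neg, neg_inj] at h
  have hint : Integrable fun y => u y • ∇ ρ (x - y) := by
    refine hG.1.integrable_smul_right_of_hasCompactSupport (g := fun y => ∇ ρ (x - y))
      ((continuous_gradient hρ.contDiff_one).comp (continuous_const.sub continuous_id)) ?_
    exact hρ.hasCompactSupport_gradient.comp_homeomorph (Homeomorph.subLeft x)
  rw [hρ.fderiv_mollify_apply hG.1, mollify_apply, ← h, real_inner_comm, ← integral_inner hint]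
  refine integral_congr_ae (Eventually.of_forall fun y => ?_)
  simp only [inner_smul_right]
  rw [real_inner_comm, inner_gradient_left, mul_comm]

theorem gradient_mollify (hG : IsWeakGradient u G) (hρ : IsTestFunction ρ) (x : E3) :
    ∇ (mollify ρ u) x = mollify ρ G x :=
  ext_inner_right ℝ fun e => by rw [inner_gradient_left, hG.fderiv_mollify_apply hρ]

/-- The Laplacian of a mollification needs only first derivatives of `u`: the second derivative
falls on the kernel. -/
theorem laplacian_mollify (hG : IsWeakGradient u G) (hρ : IsTestFunction ρ) (x : E3) :
    ∑ i, fderiv ℝ (fun z => fderiv ℝ (mollify ρ u) z (stdBasis i)) x (stdBasis i)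
      = ∫ y, inner ℝ (∇ ρ (x - y)) (G y) := by
  have hloc : ∀ e : E3, LocallyIntegrable fun y => inner ℝ (G y) e := fun e z => by
    obtain ⟨s, hs, hi⟩ := hG.2.1 z
    exact ⟨s, hs, hi.inner_const (𝕜 := ℝ) e⟩
  have h1 : ∀ e : E3, (fun z => fderiv ℝ (mollify ρ u) z e)
      = mollify ρ fun y => inner ℝ (G y) e := by
    intro e
    funext z
    rw [hG.fderiv_mollify_apply hρ, mollify_apply, mollify_apply, real_inner_comm,
      ← integral_inner (hρ.integrable_smul hG.2.1 z)]
    simp only [inner_smul_right, smul_eq_mul, real_inner_comm]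
  simp only [h1]
  rw [Finset.sum_congr rfl fun i _ => hρ.fderiv_mollify_apply (hloc (stdBasis i)) x (stdBasis i),
    ← integral_finsetSum _ fun i _ => hρ.integrable_fderiv_mul (hloc _) x _]
  refine integral_congr_ae (Eventually.of_forall fun y => ?_)
  simp only
  rw [← stdBasis.sum_inner_mul_inner]
  refine Finset.sum_congr rfl fun i _ => ?_
  rw [inner_gradient_left, real_inner_comm (G y)]

/-- If `-A Δu = g` in the sense of distributions, then `-A Δ(ρ ⋆ u) = ρ ⋆ g` pointwise. -/
theorem laplacian_mollify_of_weak_eq (hG : IsWeakGradient u G) {A : ℝ} {g : E3 → ℝ}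
    (heq : ∀ η, IsTestFunction η → A * ∫ x, inner ℝ (G x) (∇ η x) = ∫ x, g x * η x)
    (hρ : IsTestFunction ρ) (x : E3) :
    A * ∑ i, fderiv ℝ (fun z => fderiv ℝ (mollify ρ u) z (stdBasis i)) x (stdBasis i)
      = - mollify ρ g x := by
  have h := heq _ (hρ.comp_const_sub x)
  simp only [hρ.gradient_comp_const_sub, inner_neg_right, integral_neg] at h
  rw [hG.laplacian_mollify hρ, mollify_apply]
  simp only [smul_eq_mul, real_inner_comm, mul_comm (ρ _)] at h ⊢
  linarith

end IsWeakGradient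

/-- Jensen's inequality for the mollification of a square integrable vector field. -/
theorem norm_mollify_sq_le {ρ : E3 → ℝ} (hρ : IsTestFunction ρ) (h0 : ∀ x, 0 ≤ ρ x)
    (h1 : ∫ x, ρ x = 1) {G : E3 → E3} (hG : MemLp G 2) (x : E3) :
    ‖mollify ρ G x‖ ^ 2 ≤ ∫ y, ρ (x - y) * ‖G y‖ ^ 2 := by
  have hsq : Integrable fun y => ‖G y‖ ^ 2 := hG.integrable_norm_pow two_ne_zero
  obtain ⟨m, hm⟩ : ∃ m : ℝ, m = ∫ y, ρ (x - y) * ‖G y‖ := ⟨_, rfl⟩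
  have hle : ‖mollify ρ G x‖ ≤ m := by
    rw [mollify_apply]
    refine (norm_integral_le_integral_norm _).trans_eq ?_
    simp only [norm_smul, Real.norm_of_nonneg (h0 _), hm]
  have i1 : Integrable fun y => ρ (x - y) * ‖G y‖ ^ 2 := hρ.integrable_smul hsq.locallyIntegrable x
  have i2 : Integrable fun y => ρ (x - y) * ‖G y‖ := 
    hρ.integrable_smul (hG.norm.locallyIntegrable one_le_two) x
  have i3 : Integrable fun y => ρ (x - y) :=
    (hρ.comp_const_sub x).1.continuous.integrable_of_hasCompactSupport (hρ.comp_const_sub x).2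
  have hone : ∫ y, ρ (x - y) = 1 := by rw [integral_sub_left_eq_self (fun y => ρ y), h1]
  -- the variance of `‖G‖` under the probability density `ρ (x - ·)` is nonnegative
  have hvar : 0 ≤ ∫ y, ρ (x - y) * (‖G y‖ - m) ^ 2 :=
    integral_nonneg fun y => mul_nonneg (h0 _) (sq_nonneg _)
  have hexp : ∫ y, ρ (x - y) * (‖G y‖ - m) ^ 2
      = (∫ y, ρ (x - y) * ‖G y‖ ^ 2) - 2 * m * m + m ^ 2 := by
    have h2 := integral_const_mul (μ := (volume : Measure E3)) (2 * m) fun y => ρ (x - y) * ‖G y‖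
    rw [← hm] at h2
    have h3 := integral_const_mul (μ := (volume : Measure E3)) (m ^ 2) fun y => ρ (x - y)
    rw [hone, mul_one] at h3
    have h4 := integral_sub i1 (i2.const_mul (2 * m))
    have h5 := integral_add (i1.sub (i2.const_mul (2 * m))) (i3.const_mul (m ^ 2))
    simp only [Pi.sub_apply] at h5
    rw [h3, h4, h2] at h5
    rw [← h5]
    congr 1; funext y; ring
  have : ‖mollify ρ G x‖ ^ 2 ≤ m ^ 2 := pow_le_pow_left₀ (norm_nonneg _) hle 2
  nlinarith

/-- Jensen's inequality integrated against a weight `χ`; by Fubini's theorem the mollification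
moves to the weight. -/
theorem integral_mul_norm_mollify_sq_le {ρ : E3 → ℝ} (hρ : IsTestFunction ρ) (h0 : ∀ x, 0 ≤ ρ x)
    (h1 : ∫ x, ρ x = 1) (heven : ∀ x, ρ (-x) = ρ x) {G : E3 → E3} (hG : MemLp G 2)
    {χ : E3 → ℝ} (hχ : Continuous χ) (hχc : HasCompactSupport χ) (hχ0 : ∀ x, 0 ≤ χ x) :
    ∫ x, χ x * ‖mollify ρ G x‖ ^ 2 ≤ ∫ y, mollify ρ χ y * ‖G y‖ ^ 2 := by
  have hsq : Integrable fun y => ‖G y‖ ^ 2 := hG.integrable_norm_pow two_ne_zero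
  obtain ⟨M, hM⟩ := hχc.exists_bound_of_continuous hχ
  have hprod : Integrable (fun q : E3 × E3 => χ q.1 * (ρ (q.1 - q.2) * ‖G q.2‖ ^ 2))
      (volume.prod volume) := by
    have h := Integrable.convolution_integrand (ContinuousLinearMap.mul ℝ ℝ)
      (μ := (volume : Measure E3)) (ν := (volume : Measure E3)) hsq
      (hρ.1.continuous.integrable_of_hasCompactSupport hρ.2)
    have h' : Integrable (fun q : E3 × E3 => ρ (q.1 - q.2) * ‖G q.2‖ ^ 2)
        (volume.prod volume) := by
      refine h.congr (Eventually.of_forall fun q => ?_)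
      simp [mul_comm]
    exact h'.bdd_mul (hχ.comp continuous_fst).aestronglyMeasurable
      (Eventually.of_forall fun q => hM q.1)
  have hcont : Continuous fun x => χ x * ‖mollify ρ G x‖ ^ 2 :=
    hχ.mul ((hρ.contDiff_mollify (hG.locallyIntegrable one_le_two)).continuous.norm.pow 2)
  calc ∫ x, χ x * ‖mollify ρ G x‖ ^ 2
      ≤ ∫ x, ∫ y, χ x * (ρ (x - y) * ‖G y‖ ^ 2) := by
        refine integral_mono (hcont.integrable_of_hasCompactSupport hχc.mul_right)
          hprod.integral_prod_left fun x => ?_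
        simp only [integral_const_mul]
        exact mul_le_mul_of_nonneg_left (norm_mollify_sq_le hρ h0 h1 hG x) (hχ0 x)
    _ = ∫ y, ∫ x, χ x * (ρ (x - y) * ‖G y‖ ^ 2) := integral_integral_swap hprod
    _ = ∫ y, mollify ρ χ y * ‖G y‖ ^ 2 := by
        congr 1; funext y
        rw [mollify_apply, ← integral_mul_const]
        congr 1; funext x
        rw [← heven (x - y), neg_sub, smul_eq_mul]
        ring

/-! ### The local Pohozaev inequality -/

/-- A sequence of mollifiers on `ℝ³`: the `n`-th one is a smooth even probability density
supported in the ball of radius `1 / (n + 1)`. -/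
noncomputable def mollifier (n : ℕ) : E3 → ℝ :=
  (⟨1 / (2 * (n + 1)), 1 / (n + 1), by positivity, by
    gcongr; linarith [(n.cast_nonneg : (0 : ℝ) ≤ n)]⟩ : ContDiffBump (0 : E3)).normed volume

theorem isTestFunction_mollifier (n : ℕ) : IsTestFunction (mollifier n) :=
  ⟨ContDiffBump.contDiff_normed _, ContDiffBump.hasCompactSupport_normed _⟩

theorem mollifier_nonneg (n : ℕ) (x : E3) : 0 ≤ mollifier n x := ContDiffBump.nonneg_normed _ _

theorem integral_mollifier (n : ℕ) : ∫ x, mollifier n x = 1 := ContDiffBump.integral_normed _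

theorem mollifier_neg (n : ℕ) (x : E3) : mollifier n (-x) = mollifier n x :=
  ContDiffBump.normed_neg _ _

/-- Mollifications of a continuous function converge locally uniformly, in the form of joint
convergence in the index and the point. -/
theorem tendsto_mollify {f : E3 → ℝ} (hf : Continuous f) (x : E3) :
    Tendsto (fun q : ℕ × E3 => mollify (mollifier q.1) f q.2) (atTop ×ˢ 𝓝 x) (𝓝 (f x)) := by
  refine ContDiffBump.convolution_tendsto_right (x₀ := x) (g := fun _ : ℕ × E3 => f) ?_
    (Eventually.of_forall fun _ => hf.aestronglyMeasurable)
    ((hf.tendsto x).comp tendsto_snd) tendsto_snd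
  exact tendsto_one_div_add_atTop_nhds_zero_nat.comp tendsto_fst

theorem abs_mollify_mollifier_le {χ : E3 → ℝ} {M : ℝ} (hM : ∀ x, ‖χ x‖ ≤ M) (n : ℕ) (x : E3) :
    ‖mollify (mollifier n) χ x‖ ≤ M := by
  have hρ := isTestFunction_mollifier n
  have hi : Integrable fun y => mollifier n (x - y) :=
    (hρ.comp_const_sub x).1.continuous.integrable_of_hasCompactSupport (hρ.comp_const_sub x).2
  have hone : ∫ y, mollifier n (x - y) = 1 := by
    rw [integral_sub_left_eq_self (fun y => mollifier n y), integral_mollifier]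
  calc ‖mollify (mollifier n) χ x‖ ≤ ∫ y, mollifier n (x - y) * M := by
        rw [mollify_apply]
        refine norm_integral_le_of_norm_le (hi.mul_const M) (Eventually.of_forall fun y => ?_)
        rw [norm_smul, Real.norm_of_nonneg (mollifier_nonneg n _)]
        exact mul_le_mul_of_nonneg_left (hM y) (mollifier_nonneg n _)
    _ = M := by rw [integral_mul_const, hone, one_mul]

theorem eventually_abs_sub_le_of_tendsto_prod {F : ℕ → E3 → ℝ} {f : E3 → ℝ} {K : Set E3}
    (hK : IsCompact K) (hf : Continuous f)
    (h : ∀ x, Tendsto (fun q : ℕ × E3 => F q.1 q.2) (atTop ×ˢ 𝓝 x) (𝓝 (f x)))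
    {τ : ℝ} (hτ : 0 < τ) : ∀ᶠ n in atTop, ∀ x ∈ K, |F n x - f x| ≤ τ := by
  have hu : TendstoLocallyUniformly F f atTop := by
    refine tendstoLocallyUniformly_iff_forall_tendsto.2 fun x => ?_
    have h2 : Tendsto (fun q : ℕ × E3 => (f q.2, F q.1 q.2)) (atTop ×ˢ 𝓝 x) (𝓝 (f x, f x)) :=
      ((hf.tendsto x).comp tendsto_snd).prodMk_nhds (h x)
    exact h2.mono_right (nhds_le_uniformity _)
  have hK' := (tendstoLocallyUniformlyOn_iff_tendstoUniformlyOn_of_compact hK).1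
    (hu.tendstoLocallyUniformlyOn (s := K))
  filter_upwards [Metric.tendstoUniformlyOn_iff.1 hK' τ hτ] with n hn x hx
  have := (hn x hx).le
  rwa [dist_comm, Real.dist_eq] at this

theorem tendsto_integral_mul_of_tendsto_prod {F : ℕ → E3 → ℝ} {f θ : E3 → ℝ}
    (hF : ∀ n, Continuous (F n)) (hf : Continuous f)
    (h : ∀ x, Tendsto (fun q : ℕ × E3 => F q.1 q.2) (atTop ×ˢ 𝓝 x) (𝓝 (f x)))
    (hθ : Continuous θ) (hc : HasCompactSupport θ) :
    Tendsto (fun n => ∫ x, θ x * F n x) atTop (𝓝 (∫ x, θ x * f x)) := by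
  refine tendsto_integral_filter_of_dominated_convergence (fun x => |θ x| * (|f x| + 1))
    (Eventually.of_forall fun n => (hθ.mul (hF n)).aestronglyMeasurable) ?_ ?_ ?_
  · filter_upwards [eventually_abs_sub_le_of_tendsto_prod hc hf h one_pos] with n hn
    refine Eventually.of_forall fun x => ?_
    by_cases hx : x ∈ tsupport θ
    · rw [norm_mul, Real.norm_eq_abs, Real.norm_eq_abs]
      refine mul_le_mul_of_nonneg_left ?_ (abs_nonneg _)
      have := abs_sub_abs_le_abs_sub (F n x) (f x)
      linarith [hn x hx]
    · simp [image_eq_zero_of_notMem_tsupport hx]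
  · exact (hθ.abs.mul (hf.abs.add continuous_const)).integrable_of_hasCompactSupport
      (hc.norm.mul_right)
  · exact Eventually.of_forall fun x =>
      ((h x).comp (tendsto_id.prodMk tendsto_const_nhds)).const_mul _

/-- Testing the nonlinearity `v^p - V v` with `η ∂ₑv`: the integrands differ by the `e`-derivative of
`η v^{p+1} / (p + 1) - V η v² / 2`. Nothing is assumed about the sign of `v`, since `t ↦ t^{p+1}`
is continuously differentiable on the whole line for `p > 0`. -/
theorem integral_mul_fderiv_mul_rpow_sub {V v η : E3 → ℝ} {p : ℝ} (hp : 0 < p)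
    (hV : ContDiff ℝ 1 V) (hv : ContDiff ℝ 1 v) (hη : ContDiff ℝ 1 η) (hc : HasCompactSupport η)
    (e : E3) :
    ∫ x, η x * fderiv ℝ v x e * (v x ^ p - V x * v x)
      = ∫ x, (1 / 2 * (fderiv ℝ (fun z => V z * η z) x e * v x ^ 2)
          - 1 / (p + 1) * (fderiv ℝ η x e * v x ^ (p + 1))) := by
  have hVη : ContDiff ℝ 1 fun z => V z * η z := hV.mul hη
  have hpow : ContDiff ℝ 1 fun z => v z ^ (p + 1) :=
    (Real.contDiff_rpow_const_of_le (n := 1) (by simpa using hp.le)).comp hv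
  have hVηc : HasCompactSupport fun z => V z * η z := hc.mul_left
  have hW : ContDiff ℝ 1 fun z => 1 / (p + 1) * (η z * v z ^ (p + 1))
      - 1 / 2 * (V z * η z * v z ^ 2) :=
    (contDiff_const.mul (hη.mul hpow)).sub (contDiff_const.mul (hVη.mul (hv.pow 2)))
  have hWc : HasCompactSupport fun z => 1 / (p + 1) * (η z * v z ^ (p + 1))
      - 1 / 2 * (V z * η z * v z ^ 2) := by
    refine hc.mono fun x hx => ?_
    contrapose! hx
    have : η x = 0 := by simpa using hx
    simp [this]
  have hd : ∀ {f : E3 → ℝ}, ContDiff ℝ 1 f → Continuous fun x => fderiv ℝ f x e := fun hf =>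
    (hf.continuous_fderiv one_ne_zero).clm_apply continuous_const
  have hvp : Continuous fun x => v x ^ p := hv.continuous.rpow_const fun _ => Or.inr hp.le
  have i1 : Integrable fun x => η x * fderiv ℝ v x e * (v x ^ p - V x * v x) :=
    ((hη.continuous.mul (hd hv)).mul
      (hvp.sub (hV.continuous.mul hv.continuous))).integrable_of_hasCompactSupport
      hc.mul_right.mul_right
  have i2 : Integrable fun x => (1 / 2 * (fderiv ℝ (fun z => V z * η z) x e * v x ^ 2)
          - 1 / (p + 1) * (fderiv ℝ η x e * v x ^ (p + 1))) :=
    ((continuous_const.mul ((hd hVη).mul (hv.continuous.pow 2))).integrable_of_hasCompactSupport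
      ((hVηc.fderiv_apply (𝕜 := ℝ) e).mul_right.mul_left)).sub
    ((continuous_const.mul ((hd hη).mul hpow.continuous)).integrable_of_hasCompactSupport
      ((hc.fderiv_apply (𝕜 := ℝ) e).mul_right.mul_left))
  rw [← sub_eq_zero, ← integral_sub i1 i2, ← integral_fderiv_apply_eq_zero hW hWc e]
  refine integral_congr_ae (Eventually.of_forall fun x => ?_)
  have dη := hη.differentiable one_ne_zero x
  have dv := hv.differentiable one_ne_zero x
  have dp := hpow.differentiable one_ne_zero x
  have dVη := hVη.differentiable one_ne_zero x
  have e1 : fderiv ℝ (fun z => v z ^ (p + 1)) x = ((p + 1) * v x ^ p) • fderiv ℝ v x := by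
    have := (dv.hasFDerivAt.rpow_const (p := p + 1) (Or.inr (by linarith))).fderiv
    simpa using this
  have e2 : fderiv ℝ (fun z => 1 / (p + 1) * (η z * v z ^ (p + 1))
      - 1 / 2 * (V z * η z * v z ^ 2)) x e
      = 1 / (p + 1) * (η x * ((p + 1) * v x ^ p * fderiv ℝ v x e)
          + v x ^ (p + 1) * fderiv ℝ η x e)
        - 1 / 2 * (V x * η x * (2 * v x * fderiv ℝ v x e)
          + v x ^ 2 * fderiv ℝ (fun z => V z * η z) x e) := by
    rw [fderiv_fun_sub ((dη.fun_mul dp).const_mul _) ((dVη.fun_mul (dv.fun_pow 2)).const_mul _),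
      fderiv_const_mul (dη.fun_mul dp), fderiv_const_mul (dVη.fun_mul (dv.fun_pow 2)),
      fderiv_fun_mul dη dp, fderiv_fun_mul dVη (dv.fun_pow 2), e1, fderiv_fun_pow 2 dv]
    simp
    ring
  simp only [e2]
  field_simp
  ring

/-- **Local Pohozaev inequality.** Let `u` be a continuous solution of `-A Δu + V u = u^p` in the
sense of distributions, with square integrable weak gradient `G`. Formally, testing the equation
with `η ∂ₑu` bounds the weighted integral of `∂ₑV u²` by terms that only involve derivatives of
`η`. Since `η ∂ₑu` is not an admissible test function, the computation is done for mollifications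
of `u`, whose gradients are bounded in `L²` by Jensen's inequality. -/
theorem abs_integral_fderiv_potential_mul_sq_le {A p : ℝ} (hA : 0 ≤ A) (hp : 0 < p)
    {V u η : E3 → ℝ} {G : E3 → E3} (hV : ContDiff ℝ 1 V) (hu : Continuous u)
    (hG : IsWeakGradient u G) (hG2 : MemLp G 2)
    (heq : ∀ ψ, IsTestFunction ψ →
      A * ∫ x, inner ℝ (G x) (∇ ψ x) = ∫ x, (u x ^ p - V x * u x) * ψ x)
    (hη : IsTestFunction η) (e : E3) :
    |∫ x, (1 / 2 * (fderiv ℝ (fun z => V z * η z) x e * u x ^ 2)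
          - 1 / (p + 1) * (fderiv ℝ η x e * u x ^ (p + 1)))|
      ≤ 3 / 2 * A * ‖e‖ * ∫ x, ‖∇ η x‖ * ‖G x‖ ^ 2 := by
  have hsq : Integrable fun y => ‖G y‖ ^ 2 := hG2.integrable_norm_pow two_ne_zero
  have hη1 := hη.contDiff_one
  have hd : ∀ {f : E3 → ℝ}, ContDiff ℝ 1 f → Continuous fun x => fderiv ℝ f x e := fun hf =>
    (hf.continuous_fderiv one_ne_zero).clm_apply continuous_const
  have hup : Continuous fun x => u x ^ p := hu.rpow_const fun _ => Or.inr hp.le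
  have hg : Continuous fun x => u x ^ p - V x * u x := hup.sub (hV.continuous.mul hu)
  set g : E3 → ℝ := fun x => u x ^ p - V x * u x with hg_def
  -- the weights `‖∇ η‖` and `|η|`
  have hχ : Continuous fun x => ‖∇ η x‖ := (continuous_gradient hη1).norm
  have hχc : HasCompactSupport fun x => ‖∇ η x‖ := hη.hasCompactSupport_gradient.norm
  have hη0 : Continuous fun x => |η x| := hη1.continuous.abs
  have hη0c : HasCompactSupport fun x => |η x| := hη.2.norm
  obtain ⟨M, hM⟩ := hη0c.exists_bound_of_continuous hη0
  obtain ⟨N, hN⟩ := hχc.exists_bound_of_continuous hχ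
  set v : ℕ → E3 → ℝ := fun n => mollify (mollifier n) u with hv_def
  have hvs : ∀ n, ContDiff ℝ ∞ (v n) := fun n =>
    (isTestFunction_mollifier n).contDiff_mollify hG.1
  have hv1 : ∀ n, ContDiff ℝ 1 (v n) := fun n => (hvs n).of_le (by norm_cast)
  have hvg : ∀ n x, ∇ (v n) x = mollify (mollifier n) G x := fun n x =>
    hG.gradient_mollify (isTestFunction_mollifier n) x
  have hmg : ∀ n, Continuous (mollify (mollifier n) g) := fun n =>
    ((isTestFunction_mollifier n).contDiff_mollify hg.locallyIntegrable).continuous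
  have hvp : ∀ n, Continuous fun x => v n x ^ p :=
    fun n => (hv1 n).continuous.rpow_const fun _ => Or.inr hp.le
  have hder : ∀ n x, |fderiv ℝ (v n) x e| ≤ ‖∇ (v n) x‖ * ‖e‖ := fun n x => by
    rw [← inner_gradient_left]; exact abs_real_inner_le_norm _ _
  set E : ℕ → ℝ := fun n => ∫ x, η x * fderiv ℝ (v n) x e * (v n x ^ p - V x * v n x) with hE
  set I : ℕ → ℝ := fun n => ∫ x, η x * fderiv ℝ (v n) x e * mollify (mollifier n) g x with hI
  set B : ℕ → ℝ := fun n => ∫ x, mollify (mollifier n) (fun x => ‖∇ η x‖) x * ‖G x‖ ^ 2 with hB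
  have hηvc : ∀ n, Continuous fun x => η x * fderiv ℝ (v n) x e := fun n =>
    hη1.continuous.mul (hd (hv1 n))
  -- the limit of `E n`
  have hElim : Tendsto E atTop (𝓝 (∫ x, (1 / 2 * (fderiv ℝ (fun z => V z * η z) x e * u x ^ 2)
          - 1 / (p + 1) * (fderiv ℝ η x e * u x ^ (p + 1))))) := by
    have hVη : ContDiff ℝ 1 fun z => V z * η z := hV.mul hη1
    have hVηc : HasCompactSupport fun z => V z * η z := hη.2.mul_left
    have hrp : Continuous fun t : ℝ => t ^ (p + 1) :=
      continuous_id.rpow_const fun _ => Or.inr (by linarith)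
    have c1 := hVηc.fderiv_apply (𝕜 := ℝ) e
    have c2 := hη.2.fderiv_apply (𝕜 := ℝ) e
    have split : ∀ {f : E3 → ℝ}, Continuous f →
        ∫ x, (1 / 2 * (fderiv ℝ (fun z => V z * η z) x e * f x ^ 2)
          - 1 / (p + 1) * (fderiv ℝ η x e * f x ^ (p + 1)))
        = 1 / 2 * (∫ x, fderiv ℝ (fun z => V z * η z) x e * f x ^ 2)
          - 1 / (p + 1) * ∫ x, fderiv ℝ η x e * f x ^ (p + 1) := fun hf => by
      rw [integral_sub, integral_const_mul, integral_const_mul]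
      · exact (((hd hVη).mul (hf.pow 2)).integrable_of_hasCompactSupport c1.mul_right).const_mul _
      · exact (((hd hη1).mul (hrp.comp hf)).integrable_of_hasCompactSupport
          c2.mul_right).const_mul _
    have hE' : E = fun n => 1 / 2 * (∫ x, fderiv ℝ (fun z => V z * η z) x e * v n x ^ 2)
          - 1 / (p + 1) * ∫ x, fderiv ℝ η x e * v n x ^ (p + 1) := by
      funext n
      rw [hE, ← split (hv1 n).continuous]
      exact integral_mul_fderiv_mul_rpow_sub hp hV (hv1 n) hη1 hη.2 e
    rw [hE', split hu]
    refine Tendsto.sub (Tendsto.const_mul _ ?_) (Tendsto.const_mul _ ?_)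
    · exact tendsto_integral_mul_of_tendsto_prod (F := fun n x => v n x ^ 2)
        (fun n => (hv1 n).continuous.pow 2) (hu.pow 2)
        (fun x => (tendsto_mollify hu x).pow 2) (hd hVη) c1
    · exact tendsto_integral_mul_of_tendsto_prod (F := fun n x => v n x ^ (p + 1))
        (fun n => hrp.comp (hv1 n).continuous) (hrp.comp hu)
        (fun x => (hrp.tendsto _).comp (tendsto_mollify hu x)) (hd hη1) c2
  -- the limit of `B n`
  have hBlim : Tendsto B atTop (𝓝 (∫ x, ‖∇ η x‖ * ‖G x‖ ^ 2)) := by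
    refine tendsto_integral_of_dominated_convergence (fun x => N * ‖G x‖ ^ 2) (fun n => ?_)
      (hsq.const_mul N) (fun n => Eventually.of_forall fun x => ?_)
      (Eventually.of_forall fun x => ?_)
    · exact ((isTestFunction_mollifier n).contDiff_mollify
        hχ.locallyIntegrable).continuous.aestronglyMeasurable.mul hsq.aestronglyMeasurable
    · rw [norm_mul, Real.norm_of_nonneg (sq_nonneg ‖G x‖)]
      exact mul_le_mul_of_nonneg_right (abs_mollify_mollifier_le hN n x) (sq_nonneg _)
    · exact ((tendsto_mollify hχ x).comp (tendsto_id.prodMk tendsto_const_nhds)).mul_const _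
  -- the smooth identity, combined with the mollified equation
  have hIB : ∀ n, |I n| ≤ 3 / 2 * A * ‖e‖ * B n := by
    intro n
    have hv2 : ContDiff ℝ 2 (v n) := (hvs n).of_le (by norm_cast)
    have h1 : I n = - (A * ∫ x, η x * fderiv ℝ (v n) x e *
        ∑ i, fderiv ℝ (fun z => fderiv ℝ (v n) z (stdBasis i)) x (stdBasis i)) := by
      rw [← integral_const_mul, ← integral_neg]
      refine integral_congr_ae (Eventually.of_forall fun x => ?_)
      have := hG.laplacian_mollify_of_weak_eq heq (isTestFunction_mollifier n) x
      simp only [hv_def]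
      rw [mul_left_comm, this]
      simp [hg_def]
    have h2 : Integrable fun x => ‖∇ η x‖ * ‖∇ (v n) x‖ ^ 2 :=
      (hχ.mul ((continuous_gradient (hv1 n)).norm.pow 2)).integrable_of_hasCompactSupport
        hχc.mul_right
    have h3 : |∫ x, η x * fderiv ℝ (v n) x e *
        ∑ i, fderiv ℝ (fun z => fderiv ℝ (v n) z (stdBasis i)) x (stdBasis i)|
        ≤ 3 / 2 * ‖e‖ * ∫ x, ‖∇ η x‖ * ‖∇ (v n) x‖ ^ 2 := by
      rw [integral_mul_fderiv_mul_laplacian hv2 hη1 hη.2, ← integral_const_mul,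
        ← Real.norm_eq_abs]
      refine norm_integral_le_of_norm_le (h2.const_mul _) (Eventually.of_forall fun x => ?_)
      have a1 : |fderiv ℝ η x e| ≤ ‖∇ η x‖ * ‖e‖ := by
        rw [← inner_gradient_left]; exact abs_real_inner_le_norm _ _
      have a2 := abs_real_inner_le_norm (∇ η x) (∇ (v n) x)
      have a3 := hder n x
      calc ‖1 / 2 * (fderiv ℝ η x e * ‖∇ (v n) x‖ ^ 2)
            - inner ℝ (∇ η x) (∇ (v n) x) * fderiv ℝ (v n) x e‖
          ≤ 1 / 2 * (|fderiv ℝ η x e| * ‖∇ (v n) x‖ ^ 2)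
            + |inner ℝ (∇ η x) (∇ (v n) x)| * |fderiv ℝ (v n) x e| := by
            refine (norm_sub_le _ _).trans_eq ?_
            simp
        _ ≤ 1 / 2 * (‖∇ η x‖ * ‖e‖ * ‖∇ (v n) x‖ ^ 2)
            + ‖∇ η x‖ * ‖∇ (v n) x‖ * (‖∇ (v n) x‖ * ‖e‖) := by gcongr
        _ = 3 / 2 * ‖e‖ * (‖∇ η x‖ * ‖∇ (v n) x‖ ^ 2) := by ring
    have h4 : ∫ x, ‖∇ η x‖ * ‖∇ (v n) x‖ ^ 2 ≤ B n := by
      simp only [hvg]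
      exact integral_mul_norm_mollify_sq_le (isTestFunction_mollifier n) (mollifier_nonneg n)
        (integral_mollifier n) (mollifier_neg n) hG2 hχ hχc fun _ => norm_nonneg _
    rw [h1, abs_neg, abs_mul, abs_of_nonneg hA]
    calc A * _ ≤ A * (3 / 2 * ‖e‖ * B n) := by gcongr; exact h3.trans (by gcongr)
      _ = _ := by ring
  -- replacing `ρ ⋆ g` by the nonlinearity evaluated at `v n` costs an error tending to zero
  set C : ℝ := ‖e‖ * ((∫ x, |η x|) + M * ∫ x, ‖G x‖ ^ 2) with hC
  have herr : ∀ τ > 0, ∀ᶠ n in atTop, |E n - I n| ≤ τ * C := by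
    intro τ hτ
    have hr : ∀ x, Tendsto (fun q : ℕ × E3 => (v q.1 q.2 ^ p - V q.2 * v q.1 q.2)
        - mollify (mollifier q.1) g q.2) (atTop ×ˢ 𝓝 x) (𝓝 0) := by
      intro x
      have t1 := tendsto_mollify hu x
      have t2 := tendsto_mollify hg x
      have t3 : Tendsto (fun q : ℕ × E3 => V q.2) (atTop ×ˢ 𝓝 x) (𝓝 (V x)) :=
        (hV.continuous.tendsto x).comp tendsto_snd
      have := ((t1.rpow_const (p := p) (Or.inr hp.le)).sub (t3.mul t1)).sub t2
      simpa [hg_def] using this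
    filter_upwards [eventually_abs_sub_le_of_tendsto_prod
      (F := fun n x => (v n x ^ p - V x * v n x) - mollify (mollifier n) g x) hη.2
      continuous_const hr hτ] with n hn
    have j1 : Integrable fun x => η x * fderiv ℝ (v n) x e * (v n x ^ p - V x * v n x) :=
      ((hηvc n).mul ((hvp n).sub
        (hV.continuous.mul (hv1 n).continuous))).integrable_of_hasCompactSupport
        hη.2.mul_right.mul_right
    have j2 : Integrable fun x => η x * fderiv ℝ (v n) x e * mollify (mollifier n) g x :=
      ((hηvc n).mul (hmg n)).integrable_of_hasCompactSupport hη.2.mul_right.mul_right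
    have j3 : Integrable fun x => |η x| * ‖∇ (v n) x‖ ^ 2 :=
      (hη0.mul ((continuous_gradient (hv1 n)).norm.pow 2)).integrable_of_hasCompactSupport
        hη0c.mul_right
    have j4 : Integrable fun x => |η x| := hη0.integrable_of_hasCompactSupport hη0c
    have j5 : Integrable fun x => |η x| + |η x| * ‖∇ (v n) x‖ ^ 2 := j4.add j3
    have h5 : ∫ x, |η x| * ‖∇ (v n) x‖ ^ 2 ≤ M * ∫ x, ‖G x‖ ^ 2 := by
      simp only [hvg]
      refine (integral_mul_norm_mollify_sq_le (isTestFunction_mollifier n) (mollifier_nonneg n)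
        (integral_mollifier n) (mollifier_neg n) hG2 hη0 hη0c fun _ => abs_nonneg _).trans ?_
      rw [← integral_const_mul]
      refine integral_mono_of_nonneg (Eventually.of_forall fun x => ?_) (hsq.const_mul M)
        (Eventually.of_forall fun x => ?_)
      · refine mul_nonneg ?_ (sq_nonneg _)
        rw [mollify_apply]
        exact integral_nonneg fun y => mul_nonneg (mollifier_nonneg n _) (abs_nonneg _)
      · exact mul_le_mul_of_nonneg_right
          ((le_abs_self _).trans (abs_mollify_mollifier_le hM n x)) (sq_nonneg _)
    calc |E n - I n| ≤ ∫ x, τ * (‖e‖ * (|η x| + |η x| * ‖∇ (v n) x‖ ^ 2)) := by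
          rw [hE, hI, ← integral_sub j1 j2, ← Real.norm_eq_abs]
          refine norm_integral_le_of_norm_le ((j5.const_mul _).const_mul _)
            (Eventually.of_forall fun x => ?_)
          rw [← mul_sub, norm_mul, norm_mul]
          simp only [Real.norm_eq_abs]
          by_cases hx : x ∈ tsupport η
          · have b1 : |v n x ^ p - V x * v n x - mollify (mollifier n) g x| ≤ τ := by
              simpa using hn x hx
            have b2 : ‖∇ (v n) x‖ ≤ 1 + ‖∇ (v n) x‖ ^ 2 := by
              nlinarith [sq_nonneg (‖∇ (v n) x‖ - 1)]
            calc |η x| * |fderiv ℝ (v n) x e| * _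
                ≤ |η x| * ((1 + ‖∇ (v n) x‖ ^ 2) * ‖e‖) * τ := by
                  gcongr
                  exact (hder n x).trans (by gcongr)
              _ = _ := by ring
          · simp [image_eq_zero_of_notMem_tsupport hx]
      _ = τ * (‖e‖ * ((∫ x, |η x|) + ∫ x, |η x| * ‖∇ (v n) x‖ ^ 2)) := by
          rw [integral_const_mul, integral_const_mul, integral_add j4 j3]
      _ ≤ τ * C := by rw [hC]; gcongr
  have hfin : ∀ τ > 0, |∫ x, (1 / 2 * (fderiv ℝ (fun z => V z * η z) x e * u x ^ 2)
          - 1 / (p + 1) * (fderiv ℝ η x e * u x ^ (p + 1)))|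
      ≤ τ * C + 3 / 2 * A * ‖e‖ * ∫ x, ‖∇ η x‖ * ‖G x‖ ^ 2 := fun τ hτ => by
    refine le_of_tendsto_of_tendsto hElim.abs ((hBlim.const_mul _).const_add _) ?_
    filter_upwards [herr τ hτ] with n hn
    have := abs_add_le (E n - I n) (I n)
    rw [sub_add_cancel] at this
    linarith [hIB n]
  refine ge_of_tendsto (x := 𝓝[>] (0 : ℝ)) (f := fun τ : ℝ => τ * C + _) ?_
    (eventually_nhdsWithin_of_forall hfin)
  have : Tendsto (fun τ : ℝ => τ * C + 3 / 2 * A * ‖e‖ * ∫ x, ‖∇ η x‖ * ‖G x‖ ^ 2) (𝓝 0)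
      (𝓝 (0 * C + 3 / 2 * A * ‖e‖ * ∫ x, ‖∇ η x‖ * ‖G x‖ ^ 2)) :=
    (tendsto_id.mul_const C).add_const _
  simpa using this.mono_left nhdsWithin_le_nhds

/-! ### Calculus of weak gradients -/

theorem MemH1.isWeakGradient {u : E3 → ℝ} (hu : MemH1 u) : IsWeakGradient u (weakGrad u) := by
  obtain ⟨G, -, hG⟩ := hu.2
  have h : ∃ G, IsWeakGradient u G := ⟨G, hG⟩
  rw [weakGrad, dif_pos h]
  exact h.choose_spec

theorem MemH1.memLp_weakGrad {u : E3 → ℝ} (hu : MemH1 u) : MemLp (weakGrad u) 2 := by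
  obtain ⟨G, hG2, hG⟩ := hu.2
  exact (memLp_congr_ae hG.weakGrad_ae_eq).2 hG2

namespace IsWeakGradient

theorem add {u v : E3 → ℝ} {G H : E3 → E3} (hG : IsWeakGradient u G) (hH : IsWeakGradient v H) :
    IsWeakGradient (fun x => u x + v x) fun x => G x + H x := by
  refine ⟨hG.1.add hH.1, hG.2.1.add hH.2.1, fun η hη => ?_⟩
  have i : ∀ {f : E3 → ℝ}, LocallyIntegrable f → Integrable fun x => f x • ∇ η x := fun hf =>
    hf.integrable_smul_right_of_hasCompactSupport (continuous_gradient hη.contDiff_one)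
      hη.hasCompactSupport_gradient
  have j : ∀ {f : E3 → E3}, LocallyIntegrable f → Integrable fun x => η x • f x := fun hf =>
    hf.integrable_smul_left_of_hasCompactSupport hη.1.continuous hη.2
  simp only [add_smul, smul_add]
  rw [integral_add (i hG.1) (i hH.1), integral_add (j hG.2.1) (j hH.2.1), hG.2.2 η hη, hH.2.2 η hη,
    neg_add]

theorem zero : IsWeakGradient (fun _ => 0) fun _ => 0 :=
  ⟨locallyIntegrable_zero, locallyIntegrable_zero, fun η _ => by simp⟩

theorem sum {ι : Type*} (s : Finset ι) {u : ι → E3 → ℝ} {G : ι → E3 → E3}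
    (h : ∀ i, IsWeakGradient (u i) (G i)) :
    IsWeakGradient (fun x => ∑ i ∈ s, u i x) fun x => ∑ i ∈ s, G i x := by
  classical
  induction s using Finset.induction_on with
  | empty => simpa using IsWeakGradient.zero
  | insert i s hi ih => simpa [Finset.sum_insert hi] using (h i).add ih

end IsWeakGradient

/-! ### Rescaling -/

theorem integral_comp_inv_smul_sub {F : Type*} [NormedAddCommGroup F] [NormedSpace ℝ F]
    (f : E3 → F) {ε : ℝ} (hε : 0 < ε) (y : E3) :
    ∫ x, f (ε⁻¹ • (x - y)) = ε ^ 3 • ∫ z, f z := by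
  rw [integral_sub_right_eq_self (fun x => f (ε⁻¹ • x)),
    Measure.integral_comp_inv_smul_of_nonneg volume f hε.le]
  simp

theorem MeasureTheory.MemLp.comp_inv_smul_sub {F : Type*} [NormedAddCommGroup F] {f : E3 → F}
    (hf : MemLp f 2) {ε : ℝ} (hε : 0 < ε) (y : E3) :
    MemLp (fun x => f (ε⁻¹ • (x - y))) 2 := by
  have h1 : MemLp (fun x => f (ε⁻¹ • x)) 2 := by
    have hmap := Measure.map_addHaar_smul (volume : Measure E3) (inv_ne_zero hε.ne')
    have : MemLp f 2 (Measure.map (ε⁻¹ • ·) (volume : Measure E3)) := by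
      rw [hmap]
      exact hf.smul_measure ENNReal.ofReal_ne_top
    exact this.comp_of_map (measurable_const_smul _).aemeasurable
  exact h1.comp_measurePreserving (measurePreserving_sub_right volume y)

theorem IsWeakGradient.comp_inv_smul_sub {u : E3 → ℝ} {G : E3 → E3} (hG : IsWeakGradient u G)
    (hu2 : MemLp u 2) (hG2 : MemLp G 2) {ε : ℝ} (hε : 0 < ε) (y : E3) :
    IsWeakGradient (fun x => u (ε⁻¹ • (x - y))) fun x => ε⁻¹ • G (ε⁻¹ • (x - y)) := by
  refine ⟨(hu2.comp_inv_smul_sub hε y).locallyIntegrable one_le_two,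
    ((hG2.comp_inv_smul_sub hε y).const_smul ε⁻¹).locallyIntegrable one_le_two, fun η hη => ?_⟩
  have hinv : ∀ x : E3, y + ε • (ε⁻¹ • (x - y)) = x := fun x => by
    rw [smul_inv_smul₀ hε.ne']; abel
  have hη' : IsTestFunction fun z => η (y + ε • z) := by
    refine ⟨hη.1.comp (contDiff_const.add (contDiff_id.const_smul ε)), ?_⟩
    exact hη.2.comp_homeomorph
      ((Homeomorph.smulOfNeZero ε hε.ne').trans (Homeomorph.addLeft y))
  have hgrad : ∀ z, ∇ (fun z => η (y + ε • z)) z = ε • ∇ η (y + ε • z) := by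
    intro z
    have h : HasFDerivAt (fun z => η (y + ε • z))
        ((fderiv ℝ η (y + ε • z)).comp (ε • .id ℝ E3)) z :=
      ((hη.contDiff_one.differentiable one_ne_zero _).hasFDerivAt).comp z
        (((hasFDerivAt_id z).const_smul ε).const_add y)
    refine ext_inner_right ℝ fun e => ?_
    rw [inner_gradient_left, h.fderiv, inner_smul_left, inner_gradient_left]
    simp
  have key := hG.2.2 _ hη'
  simp only [hgrad] at key
  have h1 := integral_comp_inv_smul_sub (fun z => u z • ε • ∇ η (y + ε • z)) hε y
  have h2 := integral_comp_inv_smul_sub (fun z => η (y + ε • z) • G z) hε y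
  simp only [hinv] at h1 h2
  have h3 : ∫ x, u (ε⁻¹ • (x - y)) • ∇ η x
      = ε⁻¹ • ∫ x, u (ε⁻¹ • (x - y)) • ε • ∇ η x := by
    rw [← integral_smul]
    congr 1; funext x
    rw [smul_comm _ ε, inv_smul_smul₀ hε.ne']
  have h4 : ∫ x, η x • ε⁻¹ • G (ε⁻¹ • (x - y)) = ε⁻¹ • ∫ x, η x • G (ε⁻¹ • (x - y)) := by
    rw [← integral_smul]
    congr 1; funext x
    rw [smul_comm]
  rw [h3, h4, h1, h2, key, smul_neg, smul_neg]

/-- Away from its centre, a rescaled function only contributes its tail. -/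
theorem setIntegral_comp_inv_smul_sub_le {F : E3 → ℝ} (hF : Integrable F) (hF0 : ∀ z, 0 ≤ F z)
    {ε s : ℝ} (hε : 0 < ε) {y : E3} {S : Set E3} (hSm : MeasurableSet S)
    (hS : ∀ x ∈ S, s ≤ ‖x - y‖) :
    ∫ x in S, F (ε⁻¹ • (x - y)) ≤ ε ^ 3 * ∫ z, {z | s / ε ≤ ‖z‖}.indicator F z := by
  have hm : MeasurableSet {z : E3 | s / ε ≤ ‖z‖} := measurableSet_le measurable_const measurable_norm
  rw [← smul_eq_mul, ← integral_comp_inv_smul_sub _ hε y, ← integral_indicator hSm]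
  have hi : ∀ {H : E3 → ℝ}, Integrable H → Integrable fun x => H (ε⁻¹ • (x - y)) := fun hH =>
    (hH.comp_smul (inv_ne_zero hε.ne')).comp_sub_right y
  refine integral_mono ((hi hF).indicator hSm) (hi (hF.indicator hm)) fun x => ?_
  by_cases hx : x ∈ S
  · have : ε⁻¹ • (x - y) ∈ {z : E3 | s / ε ≤ ‖z‖} := by
      simp only [mem_ofPred_eq, norm_smul, norm_inv, Real.norm_of_nonneg hε.le]
      rw [div_eq_inv_mul]
      exact mul_le_mul_of_nonneg_left (hS x hx) (inv_nonneg.2 hε.le)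
    rw [indicator_of_mem hx, indicator_of_mem this]
  · rw [indicator_of_notMem hx]
    exact indicator_nonneg (fun z _ => hF0 z) _

theorem le_setIntegral_comp_inv_smul_sub {F : E3 → ℝ} (hF : Integrable F) (hF0 : ∀ z, 0 ≤ F z)
    {ε s : ℝ} (hε : 0 < ε) {y : E3} {S : Set E3} (hSm : MeasurableSet S)
    (hS : ∀ x, ‖x - y‖ ≤ s → x ∈ S) :
    ε ^ 3 * ∫ z, {z | ‖z‖ ≤ s / ε}.indicator F z ≤ ∫ x in S, F (ε⁻¹ • (x - y)) := by
  have hm : MeasurableSet {z : E3 | ‖z‖ ≤ s / ε} := measurableSet_le measurable_norm measurable_const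
  rw [← smul_eq_mul, ← integral_comp_inv_smul_sub _ hε y, ← integral_indicator hSm]
  have hi : ∀ {H : E3 → ℝ}, Integrable H → Integrable fun x => H (ε⁻¹ • (x - y)) := fun hH =>
    (hH.comp_smul (inv_ne_zero hε.ne')).comp_sub_right y
  refine integral_mono (hi (hF.indicator hm)) ((hi hF).indicator hSm) fun x => ?_
  by_cases hx : ε⁻¹ • (x - y) ∈ {z : E3 | ‖z‖ ≤ s / ε}
  · rw [indicator_of_mem hx, indicator_of_mem]
    refine hS x ?_
    simp only [mem_ofPred_eq, norm_smul, norm_inv, Real.norm_of_nonneg hε.le] at hx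
    rw [div_eq_inv_mul] at hx
    exact le_of_mul_le_mul_left hx (inv_pos.2 hε)
  · simp only [indicator_of_notMem hx]
    exact indicator_nonneg (fun z _ => hF0 _) _

theorem tendsto_integral_indicator_le_norm {F : E3 → ℝ} (hF : Integrable F) {s : ℝ} (hs : 0 < s) :
    Tendsto (fun ε : ℝ => ∫ z, {z | s / ε ≤ ‖z‖}.indicator F z) (𝓝[>] 0) (𝓝 0) := by
  suffices h : Tendsto (fun ε : ℝ => ∫ z, {z | s / ε ≤ ‖z‖}.indicator F z) (𝓝[>] 0)
      (𝓝 (∫ _ : E3, (0 : ℝ))) by rwa [integral_zero] at h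
  refine tendsto_integral_filter_of_dominated_convergence (fun z => ‖F z‖)
    (Eventually.of_forall fun ε => (hF.indicator
      (measurableSet_le measurable_const measurable_norm)).aestronglyMeasurable)
    (Eventually.of_forall fun ε => Eventually.of_forall fun z => norm_indicator_le_norm_self _ _)
    hF.norm (Eventually.of_forall fun z => ?_)
  refine tendsto_const_nhds.congr' ?_
  have ht : Tendsto (fun ε : ℝ => s / ε) (𝓝[>] 0) atTop :=
    tendsto_inv_nhdsGT_zero.const_mul_atTop hs
  filter_upwards [ht.eventually_gt_atTop ‖z‖] with ε hε
  rw [indicator_of_notMem]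
  simpa using hε

theorem tendsto_integral_indicator_norm_le {F : E3 → ℝ} (hF : Integrable F) {s : ℝ} (hs : 0 < s) :
    Tendsto (fun ε : ℝ => ∫ z, {z | ‖z‖ ≤ s / ε}.indicator F z) (𝓝[>] 0) (𝓝 (∫ z, F z)) := by
  refine tendsto_integral_filter_of_dominated_convergence (fun z => ‖F z‖)
    (Eventually.of_forall fun ε => (hF.indicator
      (measurableSet_le measurable_norm measurable_const)).aestronglyMeasurable)
    (Eventually.of_forall fun ε => Eventually.of_forall fun z => norm_indicator_le_norm_self _ _)
    hF.norm (Eventually.of_forall fun z => ?_)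
  refine tendsto_const_nhds.congr' ?_
  have ht : Tendsto (fun ε : ℝ => s / ε) (𝓝[>] 0) atTop :=
    tendsto_inv_nhdsGT_zero.const_mul_atTop hs
  filter_upwards [ht.eventually_ge_atTop ‖z‖] with ε hε
  rw [indicator_of_mem]
  simpa using hε

/-! ### Estimates for a single equation -/

/-- The local Pohozaev inequality for a cutoff `η` on whose support `∂ₑV ≥ m`, and whose gradient
is supported in a set `S` where `u ≤ 1`: the mass `∫ η u²` is controlled by the energy of `u`
in `S`. -/
theorem mul_integral_mul_sq_le {A p : ℝ} (hA : 0 ≤ A) (hp : 1 < p)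
    {V u η : E3 → ℝ} {G : E3 → E3} (hV : ContDiff ℝ 1 V) (hu : Continuous u)
    (hu2 : MemLp u 2) (hG : IsWeakGradient u G) (hG2 : MemLp G 2)
    (heq : ∀ ψ, IsTestFunction ψ →
      A * ∫ x, inner ℝ (G x) (∇ ψ x) = ∫ x, (u x ^ p - V x * u x) * ψ x)
    (hη : IsTestFunction η) {S : Set E3} (hSm : MeasurableSet S)
    (hS : ∀ x, x ∉ S → fderiv ℝ η x = 0) {m L M : ℝ} {e : E3} (hL : ∀ x, ‖∇ η x‖ ≤ L)
    (hM : ∀ x, |V x| ≤ M) (hVe : ∀ x, m * η x ≤ η x * fderiv ℝ V x e) (hu0 : ∀ x, 0 < u x)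
    (hu1 : ∀ x ∈ S, u x ≤ 1) :
    m * ∫ x, η x * u x ^ 2
      ≤ 3 * A * ‖e‖ * L * (∫ x in S, ‖G x‖ ^ 2) + (M + 1) * L * ‖e‖ * ∫ x in S, u x ^ 2 := by
  have hη1 := hη.contDiff_one
  have hL0 : 0 ≤ L := (norm_nonneg _).trans (hL 0)
  have hM0 : 0 ≤ M := (abs_nonneg _).trans (hM 0)
  have hGsq : Integrable fun y => ‖G y‖ ^ 2 := hG2.integrable_norm_pow two_ne_zero
  have husq : Integrable fun y => u y ^ 2 := hu2.integrable_sq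
  have hd : ∀ {f : E3 → ℝ}, ContDiff ℝ 1 f → Continuous fun x => fderiv ℝ f x e := fun hf =>
    (hf.continuous_fderiv one_ne_zero).clm_apply continuous_const
  have hVη : ContDiff ℝ 1 fun z => V z * η z := hV.mul hη1
  have hrp : Continuous fun x => u x ^ (p + 1) := hu.rpow_const fun _ => Or.inr (by linarith)
  set P : E3 → ℝ := fun x => 1 / 2 * (fderiv ℝ (fun z => V z * η z) x e * u x ^ 2)
          - 1 / (p + 1) * (fderiv ℝ η x e * u x ^ (p + 1)) with hP
  have hPi : Integrable P :=
    (((hd hVη).mul (hu.pow 2)).integrable_of_hasCompactSupport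
      (((HasCompactSupport.mul_left hη.2).fderiv_apply (𝕜 := ℝ) e).mul_right)).const_mul _ |>.sub
    ((((hd hη1).mul hrp).integrable_of_hasCompactSupport
      ((hη.2.fderiv_apply (𝕜 := ℝ) e).mul_right)).const_mul _)
  have hpoh : |∫ x, P x| ≤ 3 / 2 * A * ‖e‖ * ∫ x, ‖∇ η x‖ * ‖G x‖ ^ 2 :=
    abs_integral_fderiv_potential_mul_sq_le hA (by linarith) hV hu hG hG2 heq hη e
  have hgradS : ∫ x, ‖∇ η x‖ * ‖G x‖ ^ 2 ≤ L * ∫ x in S, ‖G x‖ ^ 2 := by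
    rw [← integral_indicator hSm, ← integral_const_mul]
    refine integral_mono_of_nonneg (Eventually.of_forall fun x => by positivity)
      ((hGsq.indicator hSm).const_mul L) (Eventually.of_forall fun x => ?_)
    by_cases hx : x ∈ S
    · simp only [indicator_of_mem hx]
      gcongr
      exact hL x
    · simp [indicator_of_notMem hx, gradient_eq_zero_of_fderiv (hS x hx)]
  have hpt : ∀ x, m * (η x * u x ^ 2)
      ≤ 2 * P x + (M + 1) * L * ‖e‖ * S.indicator (fun x => u x ^ 2) x := by
    intro x
    have hprod : fderiv ℝ (fun z => V z * η z) x e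
        = V x * fderiv ℝ η x e + η x * fderiv ℝ V x e := by
      rw [fderiv_fun_mul (hV.differentiable one_ne_zero x) (hη1.differentiable one_ne_zero x)]
      simp
    have hmain : m * (η x * u x ^ 2) ≤ η x * fderiv ℝ V x e * u x ^ 2 := by
      rw [← mul_assoc]
      exact mul_le_mul_of_nonneg_right (hVe x) (sq_nonneg _)
    by_cases hx : x ∈ S
    · have h1 : |fderiv ℝ η x e| ≤ L * ‖e‖ := by
        rw [← inner_gradient_left]
        exact (abs_real_inner_le_norm _ _).trans (by gcongr; exact hL x)
      have h2 : u x ^ (p + 1) ≤ u x ^ 2 := by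
        rw [← Real.rpow_natCast]
        exact Real.rpow_le_rpow_of_exponent_ge (hu0 x) (hu1 x hx) (by push_cast; linarith)
      have h3 : |V x * fderiv ℝ η x e * u x ^ 2| ≤ M * (L * ‖e‖) * u x ^ 2 := by
        rw [abs_mul, abs_mul, abs_of_nonneg (sq_nonneg (u x))]
        gcongr
        exact hM x
      have h4 : |2 / (p + 1) * (fderiv ℝ η x e * u x ^ (p + 1))| ≤ 1 * (L * ‖e‖ * u x ^ 2) := by
        rw [abs_mul, abs_mul, abs_of_nonneg (Real.rpow_nonneg (hu0 x).le _),
          abs_of_nonneg (show 0 ≤ 2 / (p + 1) by positivity)]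
        have h6 : 0 ≤ u x ^ (p + 1) := Real.rpow_nonneg (hu0 x).le _
        have h7 : 2 / (p + 1) ≤ 1 := by
          rw [div_le_one (by linarith)]
          linarith
        gcongr
      have h5 : 2 * P x = η x * fderiv ℝ V x e * u x ^ 2 + V x * fderiv ℝ η x e * u x ^ 2
          - 2 / (p + 1) * (fderiv ℝ η x e * u x ^ (p + 1)) := by
        rw [hP]
        simp only [hprod]
        ring
      rw [indicator_of_mem hx]
      linarith [neg_abs_le (V x * fderiv ℝ η x e * u x ^ 2),
        le_abs_self (2 / (p + 1) * (fderiv ℝ η x e * u x ^ (p + 1)))]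
    · have h5 : 2 * P x = η x * fderiv ℝ V x e * u x ^ 2 := by
        rw [hP]
        simp only [hprod, hS x hx]
        simp
      rw [indicator_of_notMem hx, mul_zero, add_zero, h5]
      exact hmain
  have hηu : Integrable fun x => η x * u x ^ 2 :=
    (hη1.continuous.mul (hu.pow 2)).integrable_of_hasCompactSupport hη.2.mul_right
  have hint := integral_mono (hηu.const_mul m) ((hPi.const_mul 2).add
    ((husq.indicator hSm).const_mul ((M + 1) * L * ‖e‖))) hpt
  simp only [Pi.add_apply] at hint
  rw [integral_add (hPi.const_mul 2) ((husq.indicator hSm).const_mul _), integral_const_mul,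
    integral_const_mul, integral_const_mul, integral_indicator hSm] at hint
  have hle : 3 / 2 * A * ‖e‖ * (∫ x, ‖∇ η x‖ * ‖G x‖ ^ 2)
      ≤ 3 / 2 * A * ‖e‖ * (L * ∫ x in S, ‖G x‖ ^ 2) := by gcongr
  linarith [le_abs_self (∫ x, P x)]

/-- `mul_integral_mul_sq_le` when the diffusion coefficient is `O(ε²)`, in terms of the rescaled
energy. -/
theorem mul_integral_mul_sq_le_energy {A p C ε : ℝ} (hA : 0 ≤ A) (hAC : A ≤ C * ε ^ 2) (hp : 1 < p)
    {V u η : E3 → ℝ} {G : E3 → E3} (hV : ContDiff ℝ 1 V) (hu : Continuous u)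
    (hu2 : MemLp u 2) (hG : IsWeakGradient u G) (hG2 : MemLp G 2)
    (heq : ∀ ψ, IsTestFunction ψ →
      A * ∫ x, inner ℝ (G x) (∇ ψ x) = ∫ x, (u x ^ p - V x * u x) * ψ x)
    (hη : IsTestFunction η) {S : Set E3} (hSm : MeasurableSet S)
    (hS : ∀ x, x ∉ S → fderiv ℝ η x = 0) {m L M : ℝ} {e : E3} (hL : ∀ x, ‖∇ η x‖ ≤ L)
    (hM : ∀ x, |V x| ≤ M) (hVe : ∀ x, m * η x ≤ η x * fderiv ℝ V x e) (hu0 : ∀ x, 0 < u x)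
    (hu1 : ∀ x ∈ S, u x ≤ 1) (hC : 0 ≤ C) :
    m * ∫ x, η x * u x ^ 2
      ≤ (3 * C + (M + 1)) * L * ‖e‖ * ∫ x in S, (ε ^ 2 * ‖G x‖ ^ 2 + u x ^ 2) := by
  have hpoh := mul_integral_mul_sq_le hA hp hV hu hu2 hG hG2 heq hη hSm hS hL hM hVe hu0 hu1
  have hL0 : 0 ≤ L := (norm_nonneg _).trans (hL 0)
  have hM0 : 0 ≤ M := (abs_nonneg _).trans (hM 0)
  have hSG : 0 ≤ ∫ x in S, ‖G x‖ ^ 2 := integral_nonneg fun x => sq_nonneg _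
  have hSu : 0 ≤ ∫ x in S, u x ^ 2 := integral_nonneg fun x => sq_nonneg _
  have hSsum : ∫ x in S, (ε ^ 2 * ‖G x‖ ^ 2 + u x ^ 2)
      = ε ^ 2 * (∫ x in S, ‖G x‖ ^ 2) + ∫ x in S, u x ^ 2 := by
    rw [integral_add, integral_const_mul]
    · exact ((hG2.integrable_norm_pow two_ne_zero).const_mul _).integrableOn
    · exact hu2.integrable_sq.integrableOn
  have h1 : 3 * A * ‖e‖ * L * (∫ x in S, ‖G x‖ ^ 2)
      ≤ 3 * (C * ε ^ 2) * ‖e‖ * L * (∫ x in S, ‖G x‖ ^ 2) := by gcongr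
  have h2 : 0 ≤ 3 * C * L * ‖e‖ * ∫ x in S, u x ^ 2 := by positivity
  have h3 : 0 ≤ (M + 1) * L * ‖e‖ * (ε ^ 2 * ∫ x in S, ‖G x‖ ^ 2) := by positivity
  rw [hSsum]
  linarith

theorem norm_sum_add_sq_le {F : Type*} [NormedAddCommGroup F] {k : ℕ} (f : Fin k → F) (g : F) :
    ‖∑ i, f i + g‖ ^ 2 ≤ 2 * k * ∑ i, ‖f i‖ ^ 2 + 2 * ‖g‖ ^ 2 := by
  have h1 : ‖∑ i, f i‖ ^ 2 ≤ k * ∑ i, ‖f i‖ ^ 2 := by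
    refine (pow_le_pow_left₀ (norm_nonneg _) (norm_sum_le _ _) 2).trans ?_
    simpa using sq_sum_le_card_mul_sum_sq (s := Finset.univ) (f := fun i => ‖f i‖)
  have h2 : ‖∑ i, f i + g‖ ^ 2 ≤ (‖∑ i, f i‖ + ‖g‖) ^ 2 :=
    pow_le_pow_left₀ (norm_nonneg _) (norm_add_le _ _) 2
  nlinarith [sq_nonneg (‖∑ i, f i‖ - ‖g‖)]

theorem MemH1.integrable_energy {u : E3 → ℝ} (hu : MemH1 u) (t : ℝ) :
    Integrable fun x => t * ‖weakGrad u x‖ ^ 2 + u x ^ 2 :=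
  ((hu.memLp_weakGrad.integrable_norm_pow two_ne_zero).const_mul t).add hu.1.integrable_sq

/-- The energy of a sum of rescaled peaks and a remainder, on a set away from the peaks. -/
theorem setIntegral_energy_le {k : ℕ} {w : Fin k → E3 → ℝ} {u φ : E3 → ℝ} {y : Fin k → E3}
    (hw : ∀ l, MemH1 (w l)) (hφ : MemH1 φ) (hu : MemH1 u) {ε s : ℝ} (hε : 0 < ε)
    (hform : ∀ x, u x = ∑ l, w l (ε⁻¹ • (x - y l)) + φ x) {S : Set E3} (hSm : MeasurableSet S)
    (hS : ∀ l, ∀ x ∈ S, s ≤ ‖x - y l‖) :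
    ∫ x in S, (ε ^ 2 * ‖weakGrad u x‖ ^ 2 + u x ^ 2)
      ≤ 2 * k * ∑ l, ε ^ 3 * (∫ z, {z | s / ε ≤ ‖z‖}.indicator
          (fun z => ‖weakGrad (w l) z‖ ^ 2 + w l z ^ 2) z)
        + 2 * ∫ x, (ε ^ 2 * ‖weakGrad φ x‖ ^ 2 + φ x ^ 2) := by
  have hgrad : IsWeakGradient u fun x =>
      ∑ l, ε⁻¹ • weakGrad (w l) (ε⁻¹ • (x - y l)) + weakGrad φ x := by
    rw [funext hform]
    exact (IsWeakGradient.sum _ fun l => (hw l).isWeakGradient.comp_inv_smul_sub (hw l).1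
      (hw l).memLp_weakGrad hε (y l)).add hφ.isWeakGradient
  have hF : ∀ l, Integrable fun z => ‖weakGrad (w l) z‖ ^ 2 + w l z ^ 2 := fun l => by
    simpa using (hw l).integrable_energy 1
  have hi : ∀ l, Integrable fun x =>
      (fun z => ‖weakGrad (w l) z‖ ^ 2 + w l z ^ 2) (ε⁻¹ • (x - y l)) := fun l =>
    ((hF l).comp_smul (inv_ne_zero hε.ne')).comp_sub_right (y l)
  have hpt : ∀ᵐ x, ε ^ 2 * ‖weakGrad u x‖ ^ 2 + u x ^ 2
      ≤ 2 * k * (∑ l, (fun z => ‖weakGrad (w l) z‖ ^ 2 + w l z ^ 2) (ε⁻¹ • (x - y l)))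
        + 2 * (ε ^ 2 * ‖weakGrad φ x‖ ^ 2 + φ x ^ 2) := by
    filter_upwards [hgrad.weakGrad_ae_eq] with x hx
    have h1 := norm_sum_add_sq_le (fun l => ε⁻¹ • weakGrad (w l) (ε⁻¹ • (x - y l))) (weakGrad φ x)
    have h2 := norm_sum_add_sq_le (fun l => w l (ε⁻¹ • (x - y l))) (φ x)
    rw [← hx] at h1
    rw [← hform] at h2
    simp only [Real.norm_eq_abs, sq_abs] at h2
    have h3 : ε ^ 2 * ∑ l, ‖ε⁻¹ • weakGrad (w l) (ε⁻¹ • (x - y l))‖ ^ 2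
        = ∑ l, ‖weakGrad (w l) (ε⁻¹ • (x - y l))‖ ^ 2 := by
      rw [Finset.mul_sum]
      refine Finset.sum_congr rfl fun l _ => ?_
      rw [norm_smul, norm_inv, Real.norm_of_nonneg hε.le]
      field_simp
    simp only [Finset.sum_add_distrib]
    rw [← h3]
    nlinarith [mul_le_mul_of_nonneg_left h1 (sq_nonneg ε)]
  have hisum : Integrable fun x =>
      ∑ l, (fun z => ‖weakGrad (w l) z‖ ^ 2 + w l z ^ 2) (ε⁻¹ • (x - y l)) :=
    integrable_finsetSum _ fun l _ => hi l
  have hR : Integrable fun x =>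
      2 * k * (∑ l, (fun z => ‖weakGrad (w l) z‖ ^ 2 + w l z ^ 2) (ε⁻¹ • (x - y l)))
        + 2 * (ε ^ 2 * ‖weakGrad φ x‖ ^ 2 + φ x ^ 2) :=
    (hisum.const_mul _).add ((hφ.integrable_energy _).const_mul 2)
  calc ∫ x in S, (ε ^ 2 * ‖weakGrad u x‖ ^ 2 + u x ^ 2)
      ≤ ∫ x in S, (2 * k * (∑ l, (fun z => ‖weakGrad (w l) z‖ ^ 2 + w l z ^ 2)
          (ε⁻¹ • (x - y l))) + 2 * (ε ^ 2 * ‖weakGrad φ x‖ ^ 2 + φ x ^ 2)) :=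
        integral_mono_ae (hu.integrable_energy _).integrableOn
          hR.integrableOn
          (ae_restrict_of_ae hpt)
    _ = 2 * k * (∑ l, ∫ x in S, (fun z => ‖weakGrad (w l) z‖ ^ 2 + w l z ^ 2)
          (ε⁻¹ • (x - y l))) + 2 * ∫ x in S, (ε ^ 2 * ‖weakGrad φ x‖ ^ 2 + φ x ^ 2) := by
        rw [integral_add (hisum.const_mul _).integrableOn
          ((hφ.integrable_energy _).const_mul 2).integrableOn, integral_const_mul,
          integral_const_mul, integral_finsetSum _ fun l _ => (hi l).integrableOn]
    _ ≤ _ := by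
        gcongr with l
        · exact setIntegral_comp_inv_smul_sub_le (hF l)
            (fun z => by positivity) hε hSm (hS l)
        · exact Eventually.of_forall fun x => by positivity
        · exact hφ.integrable_energy _
        · exact Measure.restrict_le_self

/-- The rescaled energy is bounded by `‖φ‖_ε²`. The continuity and boundedness of `V` make the
integral in `normEps` a genuine one. -/
theorem integral_energy_le_normEps {a v : ℝ} (ha : 0 < a) (hv : 0 < v) {V : E3 → ℝ} {M : ℝ}
    (hVc : Continuous V) (hvV : ∀ x, v ≤ V x) (hM : ∀ x, |V x| ≤ M) (ε : ℝ) {φ : E3 → ℝ}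
    (hφ : MemH1 φ) :
    ∫ x, (ε ^ 2 * ‖weakGrad φ x‖ ^ 2 + φ x ^ 2) ≤ (1 / a + 1 / v) * normEps a V ε φ ^ 2 := by
  have hV0 : ∀ x, 0 ≤ V x := fun x => hv.le.trans (hvV x)
  have hi : Integrable fun x => ε ^ 2 * a * ‖weakGrad φ x‖ ^ 2 + V x * φ x ^ 2 :=
    ((hφ.memLp_weakGrad.integrable_norm_pow two_ne_zero).const_mul _).add
      (hφ.1.integrable_sq.bdd_mul hVc.aestronglyMeasurable (Eventually.of_forall hM))
  rw [normEps, Real.sq_sqrt (integral_nonneg fun x => add_nonneg (by positivity)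
    (mul_nonneg (hV0 x) (sq_nonneg _))), ← integral_const_mul]
  refine integral_mono (hφ.integrable_energy _) (hi.const_mul _) fun x => ?_
  have h1 : φ x ^ 2 ≤ 1 / v * (V x * φ x ^ 2) := by
    rw [one_div, ← div_eq_inv_mul, le_div_iff₀ hv, mul_comm]
    exact mul_le_mul_of_nonneg_right (hvV x) (sq_nonneg _)
  have h2 : ε ^ 2 * ‖weakGrad φ x‖ ^ 2 = 1 / a * (ε ^ 2 * a * ‖weakGrad φ x‖ ^ 2) := by
    field_simp
  have h3 : 0 ≤ 1 / v * (ε ^ 2 * a * ‖weakGrad φ x‖ ^ 2) := by positivity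
  have h4 : 0 ≤ 1 / a * (V x * φ x ^ 2) :=
    mul_nonneg (by positivity) (mul_nonneg (hV0 x) (sq_nonneg _))
  simp only
  rw [h2]
  nlinarith

/-- In a set containing the ball of radius `s` about the `i`-th peak, the `L²` mass of `u` is
bounded below by that of the peak, up to the remainder: all peaks are positive, so the `i`-th one
is at most `u - φ`. -/
theorem mul_integral_peak_sq_le {k : ℕ} {w : Fin k → E3 → ℝ} {u φ η : E3 → ℝ} {y : Fin k → E3}
    (hw0 : ∀ l z, 0 < w l z) {i : Fin k} (hw : MemLp (w i) 2) (hφ : MemLp φ 2)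
    (hu : Continuous u) (hη : Continuous η) (hηc : HasCompactSupport η) (hη0 : ∀ x, 0 ≤ η x)
    {ε s : ℝ} (hε : 0 < ε)
    (hform : ∀ x, u x = ∑ l, w l (ε⁻¹ • (x - y l)) + φ x) {B : Set E3} (hBm : MeasurableSet B)
    (hB : ∀ x, ‖x - y i‖ ≤ s → x ∈ B) (hηB : ∀ x ∈ B, η x = 1) :
    ε ^ 3 * ∫ z, {z | ‖z‖ ≤ s / ε}.indicator (fun z => w i z ^ 2) z
      ≤ 2 * (∫ x, η x * u x ^ 2) + 2 * ∫ x, φ x ^ 2 := by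
  have hηu : Integrable fun x => η x * u x ^ 2 :=
    (hη.mul (hu.pow 2)).integrable_of_hasCompactSupport hηc.mul_right
  have hφ2 := hφ.integrable_sq
  refine (le_setIntegral_comp_inv_smul_sub hw.integrable_sq (fun z => sq_nonneg _) hε hBm
    hB).trans ?_
  rw [← integral_indicator hBm, ← integral_const_mul, ← integral_const_mul,
    ← integral_add (hηu.const_mul 2) (hφ2.const_mul 2)]
  refine integral_mono (((hw.integrable_sq.comp_smul
    (inv_ne_zero hε.ne')).comp_sub_right (y i)).indicator hBm)
    ((hηu.const_mul 2).add (hφ2.const_mul 2)) fun x => ?_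
  by_cases hx : x ∈ B
  · simp only [indicator_of_mem hx, hηB x hx, one_mul]
    have h1 : w i (ε⁻¹ • (x - y i)) ≤ u x - φ x := by
      rw [hform x, add_sub_cancel_right]
      exact Finset.single_le_sum (f := fun l => w l (ε⁻¹ • (x - y l)))
        (fun l _ => (hw0 l _).le) (Finset.mem_univ i)
    have h2 := pow_le_pow_left₀ (hw0 i (ε⁻¹ • (x - y i))).le h1 2
    nlinarith [sq_nonneg (u x + φ x)]
  · simp only [indicator_of_notMem hx]
    have := hη0 x
    positivity

/-- The weak equation, with the terms of order zero collected on the right. -/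
theorem IsPositiveSolution.weak_eq' {A p : ℝ} (hp : 0 < p) {V u : E3 → ℝ} (hV : Continuous V)
    (h : IsPositiveSolution A V p u) (ψ : E3 → ℝ) (hψ : IsTestFunction ψ) :
    A * ∫ x, inner ℝ (weakGrad u x) (∇ ψ x) = ∫ x, (u x ^ p - V x * u x) * ψ x := by
  have hψc := hψ.1.continuous
  have hup : Continuous fun x => u x ^ p := h.continuous.rpow_const fun _ => Or.inr hp.le
  rw [eq_sub_of_add_eq (h.weak_eq ψ hψ), ← integral_sub]
  · simp only [sub_mul]
  · exact (hup.mul hψc).integrable_of_hasCompactSupport hψ.2.mul_left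
  · exact ((hV.mul h.continuous).mul hψc).integrable_of_hasCompactSupport hψ.2.mul_left

/-! ### Concentration forces critical points -/

/-- If `V` were unbounded below, its real infimum would take the default value `0`, against
`CondV1.inf_pos`. -/
theorem CondV1.exists_bounds {V : E3 → ℝ} (h : CondV1 V) :
    ∃ v > 0, ∃ M, ∀ x, v ≤ V x ∧ |V x| ≤ M := by
  have hb : BddBelow (range V) := by
    by_contra hb
    have := h.inf_pos
    rw [Real.iInf_of_not_bddBelow hb] at this
    exact lt_irrefl _ this
  refine ⟨⨅ x, V x, h.inf_pos, ⨆ x, V x, fun x => ⟨ciInf_le hb x, ?_⟩⟩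
  rw [abs_of_nonneg (h.inf_pos.le.trans (ciInf_le hb x))]
  exact le_ciSup h.bddAbove x

theorem dirichlet_nonneg (u : E3 → ℝ) : 0 ≤ dirichlet u := integral_nonneg fun _ => sq_nonneg _

/-- The energy bound makes the Kirchhoff coefficient comparable to `ε²`. -/
theorem kirchhoff_coeff_le {a b C ε : ℝ} (ha : 0 < a) (hb : 0 < b) (hε : 0 < ε) {u : E3 → ℝ}
    (hu : MemH1 u) (hC : ∫ x, (ε ^ 2 * a * ‖weakGrad u x‖ ^ 2 + u x ^ 2) ≤ C * ε ^ 3) :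
    ε ^ 2 * a + ε * b * dirichlet u ≤ (a + b * C / a) * ε ^ 2 := by
  have hD : dirichlet u * a ≤ C * ε := by
    have h1 := integral_add
      ((hu.memLp_weakGrad.integrable_norm_pow two_ne_zero).const_mul (ε ^ 2 * a)) hu.1.integrable_sq
    rw [integral_const_mul] at h1
    rw [h1] at hC
    have h2 : 0 ≤ ∫ x, u x ^ 2 := integral_nonneg fun x => sq_nonneg _
    refine le_of_mul_le_mul_left ?_ (pow_pos hε 2)
    unfold dirichlet
    nlinarith
  have hD' : dirichlet u ≤ C * ε / a := (le_div_iff₀ ha).2 hD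
  calc ε ^ 2 * a + ε * b * dirichlet u ≤ ε ^ 2 * a + ε * b * (C * ε / a) := by gcongr
    _ = _ := by field_simp

/-- A radius isolating one of finitely many points, with a margin `s` that keeps the annulus of
radii `r / 2` and `r` away from all of them. -/
theorem exists_isolating_radius {k : ℕ} (c : Fin k → E3) (i : Fin k) {r₀ : ℝ} (hr₀ : 0 < r₀) :
    ∃ r > 0, r < r₀ ∧ ∃ s > 0, ∀ l, ∀ x ∈ Metric.closedBall (c i) r \ Metric.ball (c i) (r / 2),
      2 * s ≤ ‖x - c l‖ := by
  have small : ∀ {t : ℝ}, 0 < t → ∀ᶠ r in 𝓝[>] (0 : ℝ), r < t := fun ht =>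
    (eventually_lt_nhds ht).filter_mono nhdsWithin_le_nhds
  have h1 : ∀ᶠ r in 𝓝[>] (0 : ℝ), ∀ l, c l ≠ c i → r < dist (c l) (c i) :=
    eventually_all.2 fun l => by
      by_cases h : c l = c i
      · simp [h]
      · filter_upwards [small (dist_pos.2 h)] with r hr _ using hr
  obtain ⟨r, hr1, hrr, hr0⟩ := (h1.and ((small hr₀).and self_mem_nhdsWithin)).exists
  have hr0 : 0 < r := hr0
  have h2 : ∀ᶠ s in 𝓝[>] (0 : ℝ), ∀ l, c l ≠ c i → s < (dist (c l) (c i) - r) / 2 :=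
    eventually_all.2 fun l => by
      by_cases h : c l = c i
      · simp [h]
      · have := hr1 l h
        filter_upwards [small (show 0 < (dist (c l) (c i) - r) / 2 by linarith)] with s hs _ using hs
  obtain ⟨s, hs1, hs2, hs0⟩ :=
    (h2.and ((small (show 0 < r / 4 by linarith)).and self_mem_nhdsWithin)).exists
  refine ⟨r, hr0, hrr, s, hs0, fun l x hx => ?_⟩
  obtain ⟨hx1, hx2⟩ := hx
  rw [Metric.mem_closedBall] at hx1
  rw [Metric.mem_ball, not_lt] at hx2
  rw [← dist_eq_norm]
  by_cases h : c l = c i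
  · rw [h]; linarith
  · have := hs1 l h
    have := dist_triangle_left (c l) (c i) x
    linarith

theorem ContDiffBump.fderiv_eq_zero_of_notMem_annulus {c : E3} (χ : ContDiffBump c) {x : E3}
    (hx : x ∉ Metric.closedBall c χ.rOut \ Metric.ball c χ.rIn) : fderiv ℝ χ x = 0 := by
  by_cases hxb : x ∈ Metric.ball c χ.rIn
  · have h1 : (χ : E3 → ℝ) =ᶠ[𝓝 x] fun _ => 1 := χ.eventuallyEq_one_of_mem_ball hxb
    rw [h1.fderiv_eq]
    simp
  · have hxt : x ∉ tsupport χ := by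
      rw [χ.tsupport_eq]
      exact fun h => hx ⟨h, hxb⟩
    exact image_eq_zero_of_notMem_tsupport fun h => hxt (tsupport_fderiv_subset ℝ h)

/-- `‖φ‖_ε = o(ε^{3/2})` means that `‖φ‖_ε² / ε³` tends to zero. -/
theorem tendsto_normEps_sq_div {a : ℝ} {V : E3 → ℝ} {φ : ℝ → E3 → ℝ}
    (h : (fun ε => normEps a V ε (φ ε)) =o[𝓝[>] (0 : ℝ)] fun ε => ε ^ (3 / 2 : ℝ)) :
    Tendsto (fun ε => normEps a V ε (φ ε) ^ 2 / ε ^ 3) (𝓝[>] 0) (𝓝 0) := by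
  have h1 : Tendsto (fun ε => (normEps a V ε (φ ε) / ε ^ (3 / 2 : ℝ)) ^ 2) (𝓝[>] 0) (𝓝 0) := by
    simpa using h.tendsto_div_nhds_zero.pow 2
  refine h1.congr' ?_
  filter_upwards [self_mem_nhdsWithin] with ε hε
  have hε : 0 < ε := hε
  have h2 : (ε ^ (3 / 2 : ℝ)) ^ 2 = ε ^ 3 := by
    rw [← Real.rpow_natCast, ← Real.rpow_mul hε.le, ← Real.rpow_natCast]
    norm_num
  rw [div_pow, h2]

/-- The comparison at a fixed scale `ε`, for a cutoff `χ` centred at `z₀` on whose support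
`∂ₑV ≥ m`: after division by `ε³`, the mass of the `i`-th peak is controlled by the tails of the
profiles and the remainder. -/
theorem mul_peak_mass_le {a v p A C ε s t m L M : ℝ} (ha : 0 < a) (hv : 0 < v) (hp : 1 < p)
    {V : E3 → ℝ} (hV : ContDiff ℝ 1 V) (hvV : ∀ x, v ≤ V x) (hM : ∀ x, |V x| ≤ M)
    {k : ℕ} {w : Fin k → E3 → ℝ} {u φ : E3 → ℝ} {y : Fin k → E3} {i : Fin k}
    (hw : ∀ l, MemH1 (w l)) (hw0 : ∀ l z, 0 < w l z) (hφ : MemH1 φ) (hε : 0 < ε)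
    (hform : ∀ x, u x = ∑ l, w l (ε⁻¹ • (x - y l)) + φ x)
    (hsol : IsPositiveSolution A V p u) (hA0 : 0 ≤ A) (hA : A ≤ C * ε ^ 2)
    {z₀ e : E3} (χ : ContDiffBump z₀) (hL : ∀ x, ‖∇ χ x‖ ≤ L) (hm : 0 ≤ m)
    (hVe : ∀ x, m * χ x ≤ χ x * fderiv ℝ V x e)
    (hS : ∀ l, ∀ x ∈ Metric.closedBall z₀ χ.rOut \ Metric.ball z₀ χ.rIn, s ≤ ‖x - y l‖)
    (hu1 : ∀ x ∈ Metric.closedBall z₀ χ.rOut \ Metric.ball z₀ χ.rIn, u x ≤ 1)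
    (ht : ∀ x, ‖x - y i‖ ≤ t → x ∈ Metric.closedBall z₀ χ.rIn) :
    m * (∫ z, {z | ‖z‖ ≤ t / ε}.indicator (fun z => w i z ^ 2) z)
      ≤ 2 * ((3 * C + (M + 1)) * L * ‖e‖) * (2 * k * (∑ l, ∫ z, {z | s / ε ≤ ‖z‖}.indicator
          (fun z => ‖weakGrad (w l) z‖ ^ 2 + w l z ^ 2) z)
          + 2 * (1 / a + 1 / v) * (normEps a V ε φ ^ 2 / ε ^ 3))
        + 2 * m * (1 / a + 1 / v) * (normEps a V ε φ ^ 2 / ε ^ 3) := by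
  have hε3 := pow_pos hε 3
  have hL0 : 0 ≤ L := (norm_nonneg _).trans (hL 0)
  have hM0 : 0 ≤ M := (abs_nonneg _).trans (hM 0)
  have hC : 0 ≤ C := nonneg_of_mul_nonneg_left (hA0.trans hA) (pow_pos hε 2)
  have hmem := hsol.memH1
  have hSm : MeasurableSet (Metric.closedBall z₀ χ.rOut \ Metric.ball z₀ χ.rIn) :=
    measurableSet_closedBall.diff measurableSet_ball
  have hup := mul_integral_mul_sq_le_energy hA0 hA hp hV hsol.continuous hmem.1
    hmem.isWeakGradient hmem.memLp_weakGrad (hsol.weak_eq' (by linarith) hV.continuous)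
    ⟨χ.contDiff, χ.hasCompactSupport⟩ hSm (fun x hx => χ.fderiv_eq_zero_of_notMem_annulus hx) hL hM
    hVe hsol.pos hu1 hC
  have hrem := integral_energy_le_normEps ha hv hV.continuous hvV hM ε hφ
  have hen := setIntegral_energy_le hw hφ hmem hε hform hSm hS
  have hlow := mul_integral_peak_sq_le (η := χ) (s := t) hw0 (hw i).1 hφ.1 hsol.continuous
    χ.continuous χ.hasCompactSupport (fun x => χ.nonneg) hε hform
    measurableSet_closedBall ht (fun x hx => χ.one_of_mem_closedBall hx)
  have hφ2 : ∫ x, φ x ^ 2 ≤ ∫ x, (ε ^ 2 * ‖weakGrad φ x‖ ^ 2 + φ x ^ 2) :=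
    integral_mono hφ.1.integrable_sq (hφ.integrable_energy _) fun x => by
      simp only [le_add_iff_nonneg_left]
      positivity
  rw [← Finset.mul_sum] at hen
  have hK : 0 ≤ (3 * C + (M + 1)) * L * ‖e‖ := by positivity
  have hnorm : normEps a V ε φ ^ 2 = ε ^ 3 * (normEps a V ε φ ^ 2 / ε ^ 3) := by field_simp
  rw [hnorm] at hrem
  generalize normEps a V ε φ ^ 2 / ε ^ 3 = q at *
  generalize (3 * C + (M + 1)) * L * ‖e‖ = K at *
  generalize (1 / a + 1 / v) = κ at *
  generalize (∑ l, ∫ z, {z | s / ε ≤ ‖z‖}.indicator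
    (fun z => ‖weakGrad (w l) z‖ ^ 2 + w l z ^ 2) z) = T at *
  generalize (∫ z, {z | ‖z‖ ≤ t / ε}.indicator (fun z => w i z ^ 2) z) = J at *
  refine le_of_mul_le_mul_left ?_ hε3
  have h1 := mul_le_mul_of_nonneg_left
    (hen.trans (add_le_add_right (mul_le_mul_of_nonneg_left hrem zero_le_two) _)) hK
  have h2 := mul_le_mul_of_nonneg_left
    (hlow.trans (add_le_add_right (mul_le_mul_of_nonneg_left (hφ2.trans hrem) zero_le_two) _)) hm
  linarith

theorem lemma2p6 (a b p : ℝ) (ha : 0 < a) (hb : 0 < b) (hp1 : 1 < p) (hp5 : p < 5)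
    (V : E3 → ℝ) (hV1 : CondV1 V) (hV : ContDiff ℝ 1 V)
    (k : ℕ) (hk : 1 ≤ k) (c : Fin k → E3) (hc : Function.Injective c)
    (y : ℝ → Fin k → E3) (w : Fin k → E3 → ℝ) (φ u : ℝ → E3 → ℝ)
    (hu : IsMultiPeakSolution a b p V c y u)
    (hform : HasPeakForm a b p V c y w φ u) :
    ∀ i, ∇ V (c i) = 0 := by
  intro i
  by_contra he
  obtain ⟨v, hv, M, hVM⟩ := hV1.exists_bounds
  set e : E3 := ∇ V (c i) with he_def
  set m : ℝ := ‖e‖ ^ 2 / 2 with hm_def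
  have henorm : 0 < ‖e‖ := norm_pos_iff.2 he
  have hm : 0 < m := by positivity
  -- a ball in which `∂ₑV > m`
  obtain ⟨r₀, hr₀, hball⟩ : ∃ r₀ > 0, ∀ x ∈ Metric.ball (c i) r₀, m < fderiv ℝ V x e := by
    have hcont : Continuous fun x => fderiv ℝ V x e :=
      (hV.continuous_fderiv one_ne_zero).clm_apply continuous_const
    have h0 : m < fderiv ℝ V (c i) e := by
      rw [← inner_gradient_left, ← he_def, real_inner_self_eq_norm_sq, hm_def]
      linarith [pow_pos henorm 2]
    exact Metric.eventually_nhds_iff_ball.1 (hcont.continuousAt.eventually (lt_mem_nhds h0))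
  obtain ⟨r, hr, hrr₀, s, hs, hsep⟩ := exists_isolating_radius c i hr₀
  let χ : ContDiffBump (c i) := ⟨r / 2, r, half_pos hr, half_lt_self hr⟩
  have hη : IsTestFunction χ := ⟨χ.contDiff, χ.hasCompactSupport⟩
  obtain ⟨L, hL⟩ := hη.hasCompactSupport_gradient.exists_bound_of_continuous
    (continuous_gradient hη.contDiff_one)
  have hVe : ∀ x, m * χ x ≤ χ x * fderiv ℝ V x e := by
    intro x
    rw [mul_comm]
    by_cases hx : x ∈ Metric.ball (c i) r
    · exact mul_le_mul_of_nonneg_left (hball x (Metric.ball_subset_ball hrr₀.le hx)).le χ.nonneg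
    · rw [χ.zero_of_le_dist (not_lt.1 hx)]
      simp
  obtain ⟨C, hC0, hC⟩ := hu.energy
  -- the level `1` is where `u ^ (p + 1) ≤ u ^ 2` starts to hold
  obtain ⟨R, hR0, hR⟩ := hu.decay 1 one_pos
  have hw : ∀ l, MemH1 (w l) := fun l => (hform.limit l).1.memH1
  have hF : ∀ l, Integrable fun z => ‖weakGrad (w l) z‖ ^ 2 + w l z ^ 2 := fun l => by
    simpa using (hw l).integrable_energy 1
  have hy : ∀ {δ : ℝ}, 0 < δ → ∀ᶠ ε in 𝓝[>] (0 : ℝ), ∀ l, ‖y ε l - c l‖ < δ := fun hδ =>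
    eventually_all.2 fun l => by
      simpa [dist_eq_norm] using (hu.tendsto l).eventually (Metric.ball_mem_nhds (c l) hδ)
  have hRε : ∀ᶠ ε in 𝓝[>] (0 : ℝ), ε < s / R :=
    (eventually_lt_nhds (div_pos hs hR0)).filter_mono nhdsWithin_le_nhds
  have hq := tendsto_normEps_sq_div hform.small
  have hlim := ((((tendsto_finsetSum Finset.univ fun l _ =>
    tendsto_integral_indicator_le_norm (hF l) hs).const_mul (2 * (k : ℝ))).add
      (hq.const_mul (2 * (1 / a + 1 / v)))).const_mul
        (2 * ((3 * (a + b * C / a) + (M + 1)) * L * ‖e‖))).add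
      (hq.const_mul (2 * m * (1 / a + 1 / v)))
  -- in the limit `ε → 0` the estimate at scale `ε` says that `m ∫ (wⁱ)² ≤ 0`
  have hle := le_of_tendsto_of_tendsto ((tendsto_integral_indicator_norm_le
    (hw i).1.integrable_sq (show 0 < r / 4 by linarith)).const_mul m) hlim (by
    filter_upwards [self_mem_nhdsWithin, hu.solution, hC, hR, hform.form, hform.memH1, hy hs,
      hy (show 0 < r / 4 by linarith), hRε] with ε hε hsol hCε hRε' hformε hφ hys hyr hεs
    have hε : 0 < ε := hε
    have hSy : ∀ l, ∀ x ∈ Metric.closedBall (c i) r \ Metric.ball (c i) (r / 2),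
        s ≤ ‖x - y ε l‖ := fun l x hx => by
      have h1 := hsep l x hx
      have h2 := norm_sub_le_norm_sub_add_norm_sub x (y ε l) (c l)
      linarith [hys l]
    refine mul_peak_mass_le ha hv hp1 hV (fun x => (hVM x).1) (fun x => (hVM x).2) hw
      (fun l => (hform.limit l).1.pos) hφ hε hformε hsol ?_
      (kirchhoff_coeff_le ha hb hε hsol.memH1 hCε) χ hL hm.le hVe hSy ?_ ?_
    · have := dirichlet_nonneg (u ε)
      positivity
    · intro x hx
      refine (le_abs_self _).trans (hRε' x ?_)
      simp only [mem_iUnion, Metric.mem_ball, not_exists, not_lt, dist_eq_norm]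
      intro l
      rw [lt_div_iff₀ hR0] at hεs
      linarith [hSy l x hx]
    · intro x hx
      rw [Metric.mem_closedBall, dist_eq_norm]
      have h2 := norm_sub_le_norm_sub_add_norm_sub x (y ε i) (c i)
      have h3 : χ.rIn = r / 2 := rfl
      linarith [hyr i])
  have hpos : 0 < ∫ z, w i z ^ 2 := by
    have hwpos := (hform.limit i).1.pos
    rw [integral_pos_iff_support_of_nonneg (fun z => sq_nonneg _) (hw i).1.integrable_sq]
    have : Function.support (fun z => w i z ^ 2) = univ :=
      eq_univ_of_forall fun z => (pow_pos (hwpos z) 2).ne'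
    rw [this]
    exact Measure.measure_univ_pos.2 (NeZero.ne _)
  have := mul_pos hm hpos
  simp only [Finset.sum_const_zero, mul_zero, add_zero] at hle
  linarith
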